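/- A $k$-counter machine over a finite input alphabet $\Sigma$ has a finite set of states with an initial state and a set of final states, one two-way read-only head on the tape $\vdash w \dashv$ holding the input $w\in\Sigma^*$ between end-markers, and $k$ counters holding non-negative integers of unbounded size. The head starts on the first symbol of $w$ (on $\dashv$ if $w$ is empty) and all counters start at zero. Depending on the state, the scanned symbol and the set of counters that are zero, the machine in one step changes its state, moves the head by $-1$, $0$ or $1$ and adds $-1$, $0$ or $1$ to each counter (the head does not leave the tape, and decrementing a zero counter leaves it zero). The machine is deterministic if in every such situation at most one move is available; in general it may be nondeterministic. A computation halts when no move is available, and it accepts if it halts in a final state, with the head at any position. The machine operates in time $t(n)$ if every computation on an input of length $n$ makes at most $t(n)$ steps; it accepts in time $t(n)$ if every accepted input of length $n$ has an accepting computation of at most $t(n)$ steps. Theorem. Let $M$ be a $k$-counter machine that accepts a language $L \subseteq w_1^*w_2^*\cdots w_m^*$, where $w_1,\dots,w_m\in\Sigma^*$ are fixed words, not necessarily distinct, and let $t:\mathbb{N}\to\mathbb{R}$. For every constant $c>0$ there is a counter machine $M'$ with $k+m$ counters that accepts the same language $L$, is deterministic if $M$ is, operates in time $n+c\,t(n)$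 if $M$ operates in time $t(n)$, and accepts in time $n+c\,t(n)$ if $M$ accepts in time $t(n)$. -/

import Mathlib

open scoped Computability

/-- What the input head can scan: the left end-marker, a letter, or the right end-marker. -/
inductive TapeSymbol (α : Type*) where
  | left : TapeSymbol α
  | letter (a : α) : TapeSymbol α
  | right : TapeSymbol α

/-- A (possibly nondeterministic) two-way machine with `k` unbounded counters over the input
alphabet `α`. `trans q a z` is the set of moves available in state `q` when the input head scans
`a` and `z i` tells whether counter `i` is zero. A move `(q', d, e)` enters state `q'`, moves the
head by `d ∈ {-1, 0, 1}` and adds `e i ∈ {-1, 0, 1}` to counter `i`, all in one step. -/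
structure CounterMachine (α : Type*) (k : ℕ) where
  State : Type
  finite_state : Finite State
  start : State
  final : Set State
  trans : State → TapeSymbol α → (Fin k → Bool) → Set (State × SignType × (Fin k → SignType))

namespace CounterMachine

variable {α : Type*} {k : ℕ}

/-- Configurations: state, head position (`0` is the left end-marker, the letters of the input `w`
occupy positions `1, …, |w|`, and `|w| + 1` is the right end-marker), and counter contents. -/
@[ext]
structure Config (M : CounterMachine α k) where
  state : M.State
  pos : ℕ
  counter : Fin k → ℕ

/-- The symbol at position `p` of the tape holding `w` between end-markers. -/
def scan (w : List α) : ℕ → TapeSymbol α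
  | 0 => TapeSymbol.left
  | p + 1 =>
    match w[p]? with
    | some a => TapeSymbol.letter a
    | none => TapeSymbol.right

/-- The head starts on the first letter (on the right end-marker if the input is empty) and all
counters start at zero. -/
def init (M : CounterMachine α k) : M.Config where
  state := M.start
  pos := 1
  counter := fun _ => 0

/-- The moves available in configuration `c` on input `w`. -/
def moves (M : CounterMachine α k) (w : List α) (c : M.Config) :
    Set (M.State × SignType × (Fin k → SignType)) :=
  M.trans c.state (scan w c.pos) (fun i => decide (c.counter i = 0))

/-- The effect of a move. The head does not leave the tape with its end-markers, and a counter
holding zero stays at zero when it is decremented. -/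
def apply (M : CounterMachine α k) (w : List α) (c : M.Config)
    (μ : M.State × SignType × (Fin k → SignType)) : M.Config where
  state := μ.1
  pos := min (w.length + 1) ((c.pos : ℤ) + (μ.2.1 : ℤ)).toNat
  counter := fun i => ((c.counter i : ℤ) + (μ.2.2 i : ℤ)).toNat

/-- `M.Reaches w s c`: some computation of `M` on input `w` is in configuration `c` after exactly
`s` steps. -/
inductive Reaches (M : CounterMachine α k) (w : List α) : ℕ → M.Config → Prop
  | zero : Reaches M w 0 M.init
  | succ {s : ℕ} {c : M.Config} {μ : M.State × SignType × (Fin k → SignType)} :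
      Reaches M w s c → μ ∈ M.moves w c → Reaches M w (s + 1) (M.apply w c μ)

/-- Some computation on `w` halts (no move is available) in a final state after exactly `s` steps,
the head being at any position. -/
def AcceptsIn (M : CounterMachine α k) (w : List α) (s : ℕ) : Prop :=
  ∃ c : M.Config, M.Reaches w s c ∧ M.moves w c = ∅ ∧ c.state ∈ M.final

/-- The language accepted by `M`. -/
def language (M : CounterMachine α k) : Language α :=
  {w | ∃ s, M.AcceptsIn w s}

/-- At most one move is available in every situation. -/
def Deterministic (M : CounterMachine α k) : Prop :=
  ∀ q a z, (M.trans q a z).Subsingleton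

/-- Every computation on an input of length `n` makes at most `t n` steps. -/
def HaltsInTime (M : CounterMachine α k) (t : ℕ → ℝ) : Prop :=
  ∀ w s c, M.Reaches w s c → (s : ℝ) ≤ t w.length

/-- Every accepted input of length `n` is accepted by a computation of at most `t n` steps. -/
def AcceptsInTime (M : CounterMachine α k) (t : ℕ → ℝ) : Prop :=
  ∀ w ∈ M.language, ∃ s, M.AcceptsIn w s ∧ (s : ℝ) ≤ t w.length

end CounterMachine

/-- The language `w₁* w₂* ⋯ wₘ*` for the sequence of words `ws = [w₁, …, wₘ]`. -/
def boundLanguage {α : Type*} (ws : List (List α)) : Language α :=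
  (ws.map fun w => ({w} : Language α)∗).prod

/-! One step of the new machine does the work of `K` steps of `M`. A counter of `M` is stored as `K
* cnt + ρ` with `ρ < K` kept in the state. A counter with `cnt > 0` cannot be found zero during the
next `K` steps, one with `cnt = 0` is known exactly, and in both cases `cnt` changes by at most one.

The head of `M` is followed on a compressed tape `u₀ D₁^{n₁} u₁ ⋯ Dᵣ^{nᵣ} uᵣ`. The words have
bounded length and live in the state; each has at least `Q ≥ K` letters, so `K` steps stay within
the current cell and its two neighbours (`Margin`, `Represents.window`). On a run, the copies on the
two sides of the current one need separate registers, hence `r + 1` registers in all. Only `r ≤ m`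
of them are counters: the other is the input head, which is idle after reading and stores a number
as its distance from the right end-marker. `reg_zero_lt` shows that there is room for it.

The compression is found while reading. With `Q` a common multiple of the lengths of the nonempty
`wᵢ`, the input has period `Q` except shortly after the at most `m` places where a new block starts.
The parser opens a run when its unparsed rest ends in a cube `E E E` with `|E| = Q`. Every new run
can be charged to a new block start (`Bounded.absorb`), and a long rest would contain a cube
(`Bounded.length_rest`). So `m` exponents and finitely many states suffice for inputs of the bounded
language; on others the parser may get stuck, which rejects.

Reading takes `n` steps, starting the simulation one, the simulation `j` with `K * j` bounded by the
time of `M`, and accepting one. The overhead `2` must be absorbed even when `t n` is small.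
Therefore computations of fewer than `E` steps are decided during reading, from a prefix of length
`E + 1`, and the parser is entered only if `M` has a computation of `E` steps. `FastInv.step` gives
soundness and the bound on all computations, `fast_acceptsIn` completeness and the bound on
accepting ones. -/

namespace TapeSymbol

instance {α : Type*} [Finite α] : Finite (TapeSymbol α) :=
  Finite.of_injective
    (fun a : TapeSymbol α => (match a with
      | left => none
      | letter a => some (some a)
      | right => some none : Option (Option α)))
    (by rintro (_ | _ | _) (_ | _ | _) h <;> simp_all)

/-- The new head position after moving by `d` away from a cell holding the given symbol. -/
def headMove {α : Type*} : TapeSymbol α → ℕ → SignType → ℕ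
  | left, p, d => if d = 1 then p + 1 else p
  | letter _, p, d => ((p : ℤ) + (d : ℤ)).toNat
  | right, p, d => if d = -1 then p - 1 else p

variable {α : Type*}

theorem headMove_le (a : TapeSymbol α) (p : ℕ) (d : SignType) : a.headMove p d ≤ p + 1 := by
  cases a <;> cases d <;> simp [headMove]
  omega

theorem le_headMove (a : TapeSymbol α) (p : ℕ) (d : SignType) : p ≤ a.headMove p d + 1 := by
  cases a <;> cases d <;> simp [headMove] <;> omega

/-- Truncation at `0` is the only obstruction to translating a move, and it cannot occur from a
position `p ≥ 1`. -/
theorem headMove_add (a : TapeSymbol α) (p₀ p : ℕ) (d : SignType) (h : p₀ = 0 ∨ 1 ≤ p) :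
    a.headMove (p₀ + p) d = p₀ + a.headMove p d := by
  cases a <;> cases d <;> simp [headMove] <;> omega

end TapeSymbol

/-! ### Computations on pieces of the tape -/

namespace CounterMachine

variable {α : Type*} {k : ℕ}

/-- The tape holding `w` between end-markers. -/
def tape (w : List α) : List (TapeSymbol α) :=
  TapeSymbol.left :: (w.map TapeSymbol.letter ++ [TapeSymbol.right])

@[simp] theorem length_tape (w : List α) : (tape w).length = w.length + 2 := by simp [tape]

theorem tape_getElem? (w : List α) {p : ℕ} (hp : p ≤ w.length + 1) :
    (tape w)[p]? = some (scan w p) := by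
  rcases p with _ | p
  · simp [tape, scan]
  · rcases lt_or_ge p w.length with h | h
    · simp [tape, scan, h, List.getElem?_append]
    · have : p = w.length := by omega
      subst this
      simp [tape, scan]

theorem scan_eq_right_iff (w : List α) {p : ℕ} (hp : p ≤ w.length + 1) :
    scan w p = TapeSymbol.right ↔ p = w.length + 1 := by
  rcases p with _ | p
  · simp [scan]
  · rcases lt_or_ge p w.length with h | h
    · simp [scan, h]; omega
    · have : p = w.length := by omega
      subst this
      simp [scan]

theorem headMove_scan (w : List α) {p : ℕ} (hp : p ≤ w.length + 1) (d : SignType) :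
    (scan w p).headMove p d = min (w.length + 1) ((p : ℤ) + (d : ℤ)).toNat := by
  rcases p with _ | p
  · cases d <;> simp [scan, TapeSymbol.headMove]
  · rcases lt_or_ge p w.length with h | h
    · cases d <;> simp [scan, h, TapeSymbol.headMove] <;> omega
    · have : p = w.length := by omega
      subst this
      cases d <;> simp [scan, TapeSymbol.headMove]

variable (M : CounterMachine α k)

/-- The effect of a move made while scanning `a`. -/
def applyOn (a : TapeSymbol α) (c : M.Config) (μ : M.State × SignType × (Fin k → SignType)) :
    M.Config where
  state := μ.1
  pos := a.headMove c.pos μ.2.1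
  counter := fun i => ((c.counter i : ℤ) + (μ.2.2 i : ℤ)).toNat

/-- One step on a piece `T` of a tape; the head positions count from the beginning of `T`. -/
def StepOn (T : List (TapeSymbol α)) (c c' : M.Config) : Prop :=
  ∃ a, T[c.pos]? = some a ∧
    ∃ μ ∈ M.trans c.state a (fun i => decide (c.counter i = 0)), c' = M.applyOn a c μ

/-- `n` successive steps on a piece of a tape. -/
def StepsOn (T : List (TapeSymbol α)) : ℕ → M.Config → M.Config → Prop
  | 0, c, c' => c = c'
  | n + 1, c, c' => ∃ c₁, M.StepOn T c c₁ ∧ StepsOn T n c₁ c'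

/-- No step is possible on a piece of a tape. -/
def HaltedOn (T : List (TapeSymbol α)) (c : M.Config) : Prop := ∀ c', ¬ M.StepOn T c c'

variable {M} {T : List (TapeSymbol α)}

theorem stepsOn_add {a b : ℕ} {c c' : M.Config} :
    M.StepsOn T (a + b) c c' ↔ ∃ c₁, M.StepsOn T a c c₁ ∧ M.StepsOn T b c₁ c' := by
  induction a generalizing c with
  | zero => simp [StepsOn]
  | succ a ih =>
    rw [Nat.succ_add]
    simp only [StepsOn, ih]
    constructor
    · rintro ⟨c₁, h, c₂, h', h''⟩; exact ⟨c₂, ⟨c₁, h, h'⟩, h''⟩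
    · rintro ⟨c₂, ⟨c₁, h, h'⟩, h''⟩; exact ⟨c₁, h, c₂, h', h''⟩

theorem stepsOn_succ {n : ℕ} {c c' : M.Config} :
    M.StepsOn T (n + 1) c c' ↔ ∃ c₁, M.StepsOn T n c c₁ ∧ M.StepOn T c₁ c' := by
  rw [stepsOn_add]; simp [StepsOn]

theorem StepsOn.counter_le {n : ℕ} {c c' : M.Config} (h : M.StepsOn T n c c') (i : Fin k) :
    c'.counter i ≤ c.counter i + n := by
  induction n generalizing c with
  | zero => cases h; simp
  | succ n ih =>
    obtain ⟨c₁, ⟨a, -, μ, -, rfl⟩, h⟩ := h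
    have := ih h
    simp only [applyOn] at this
    cases h : μ.2.2 i <;> simp [h] at this <;> omega

theorem Deterministic.stepOn_unique (hM : M.Deterministic) {c c₁ c₂ : M.Config}
    (h₁ : M.StepOn T c c₁) (h₂ : M.StepOn T c c₂) : c₁ = c₂ := by
  obtain ⟨a, ha, μ, hμ, rfl⟩ := h₁
  obtain ⟨b, hb, ν, hν, rfl⟩ := h₂
  obtain rfl : a = b := by simpa [ha] using hb
  rw [hM _ _ _ hμ hν]

theorem Deterministic.stepsOn_unique (hM : M.Deterministic) {n : ℕ} {c c₁ c₂ : M.Config}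
    (h₁ : M.StepsOn T n c c₁) (h₂ : M.StepsOn T n c c₂) : c₁ = c₂ := by
  induction n generalizing c with
  | zero => cases h₁; cases h₂; rfl
  | succ n ih =>
    obtain ⟨d₁, h₁, h₁'⟩ := h₁
    obtain ⟨d₂, h₂, h₂'⟩ := h₂
    obtain rfl := hM.stepOn_unique h₁ h₂
    exact ih h₁' h₂'

/-- This makes "accepts in fewer than `n` steps" and "runs for `n` steps" exclusive, so that the
accelerated machine never has both choices when `M` is deterministic. -/
theorem Deterministic.not_stepsOn_of_halted (hM : M.Deterministic) {j n : ℕ} (hj : j < n)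
    {c c₁ c₂ : M.Config} (h₁ : M.StepsOn T j c c₁) (hc : M.HaltedOn T c₁) :
    ¬ M.StepsOn T n c c₂ := by
  intro h₂
  obtain ⟨d, rfl⟩ : ∃ d, n = j + (d + 1) := ⟨n - j - 1, by omega⟩
  obtain ⟨c₃, h₃, c₄, h₄, -⟩ := stepsOn_add.1 h₂
  obtain rfl := hM.stepsOn_unique h₁ h₃
  exact hc _ h₄

/-! ### Steps on the whole tape -/

theorem stepOn_tape {w : List α} {c c' : M.Config} (hc : c.pos ≤ w.length + 1) :
    M.StepOn (tape w) c c' ↔ ∃ μ ∈ M.moves w c, c' = M.apply w c μ := by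
  have key : ∀ μ, M.applyOn (scan w c.pos) c μ = M.apply w c μ := fun μ => by
    simp [applyOn, apply, headMove_scan w hc]
  simp [StepOn, tape_getElem? w hc, moves, key]

theorem StepOn.pos_le {w : List α} {c c' : M.Config} (hc : c.pos ≤ w.length + 1)
    (h : M.StepOn (tape w) c c') : c'.pos ≤ w.length + 1 := by
  obtain ⟨μ, -, rfl⟩ := (stepOn_tape hc).1 h
  simp [apply]

theorem StepsOn.pos_le {w : List α} {n : ℕ} {c c' : M.Config} (hc : c.pos ≤ w.length + 1)
    (h : M.StepsOn (tape w) n c c') : c'.pos ≤ w.length + 1 := by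
  induction n generalizing c with
  | zero => cases h; exact hc
  | succ n ih =>
    obtain ⟨c₁, h, h'⟩ := h
    exact ih (h.pos_le hc) h'

theorem haltedOn_tape {w : List α} {c : M.Config} (hc : c.pos ≤ w.length + 1) :
    M.HaltedOn (tape w) c ↔ M.moves w c = ∅ := by
  simp only [HaltedOn, stepOn_tape hc, Set.eq_empty_iff_forall_notMem]
  exact ⟨fun h μ hμ => h _ ⟨μ, hμ, rfl⟩, fun h c' ⟨μ, hμ, _⟩ => h μ hμ⟩

theorem init_pos_le (w : List α) : M.init.pos ≤ w.length + 1 := by simp [init]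

theorem reaches_iff {w : List α} {s : ℕ} {c : M.Config} :
    M.Reaches w s c ↔ M.StepsOn (tape w) s M.init c := by
  constructor
  · intro h
    induction h with
    | zero => rfl
    | succ _ hμ ih =>
      exact stepsOn_succ.2 ⟨_, ih, (stepOn_tape (ih.pos_le (init_pos_le w))).2 ⟨_, hμ, rfl⟩⟩
  · intro h
    induction s generalizing c with
    | zero => cases h; exact .zero
    | succ s ih =>
      obtain ⟨c₁, h₁, h₂⟩ := stepsOn_succ.1 h
      obtain ⟨μ, hμ, rfl⟩ := (stepOn_tape (h₁.pos_le (init_pos_le w))).1 h₂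
      exact (ih h₁).succ hμ

theorem acceptsIn_iff {w : List α} {s : ℕ} :
    M.AcceptsIn w s ↔ ∃ c, M.StepsOn (tape w) s M.init c ∧ M.HaltedOn (tape w) c ∧
      c.state ∈ M.final := by
  refine exists_congr fun c => ?_
  rw [reaches_iff]
  exact and_congr_right fun h => by rw [haltedOn_tape (h.pos_le (init_pos_le w))]

/-! ### Steps on a window of the tape -/

/-- Translate head position and counters. -/
def shift (p : ℕ) (e : Fin k → ℕ) (c : M.Config) : M.Config where
  state := c.state
  pos := p + c.pos
  counter := fun i => e i + c.counter i

/-- On the tape `X ++ V ++ Y`, the configuration `c` of the window `V` cannot leave the window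
within `b` steps, and no counter that has been decreased by some `e i > 0` can underflow. -/
structure Margin (b : ℕ) (X V Y : List (TapeSymbol α)) (e : Fin k → ℕ) (c : M.Config) : Prop where
  left : X = [] ∨ b ≤ c.pos
  right : c.pos + b < V.length ∨ (Y = [] ∧ c.pos < V.length)
  counter : ∀ i, e i = 0 ∨ b ≤ c.counter i

section Window

variable {w : List α} {X V Y : List (TapeSymbol α)} {e : Fin k → ℕ} {b : ℕ} {c : M.Config}

theorem Margin.pos_lt (h : Margin b X V Y e c) : c.pos < V.length := by
  rcases h.right with h | h <;> omega

theorem Margin.getElem? (h : Margin b X V Y e c) :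
    (X ++ V ++ Y)[(shift X.length e c).pos]? = V[c.pos]? := by
  have := h.pos_lt
  simp [shift, List.getElem?_append, this]

theorem Margin.applyOn_shift (h : Margin (b + 1) X V Y e c) (a : TapeSymbol α)
    (μ : M.State × SignType × (Fin k → SignType)) :
    M.applyOn a (shift X.length e c) μ = shift X.length e (M.applyOn a c μ) := by
  ext i
  · rfl
  · apply TapeSymbol.headMove_add
    rcases h.left with rfl | h
    · simp
    · omega
  · simp only [applyOn, shift]
    rcases h.counter i with h | h <;> cases μ.2.2 i <;> simp [h] <;> omega

/-- A counter that has been decreased still holds at least `b + 1` on the window, so it is nonzero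
before and after translation. -/
theorem Margin.zero_test (h : Margin (b + 1) X V Y e c) :
    (fun i => decide ((shift X.length e c).counter i = 0)) = fun i => decide (c.counter i = 0) := by
  funext i
  have : (e i + c.counter i = 0) ↔ c.counter i = 0 := by
    rcases h.counter i with h | h <;> omega
  simp only [shift]
  exact decide_eq_decide.2 this

theorem Margin.stepOn_iff (h : Margin (b + 1) X V Y e c) {c' : M.Config} :
    M.StepOn (X ++ V ++ Y) (shift X.length e c) c' ↔
      ∃ d, M.StepOn V c d ∧ c' = shift X.length e d := by
  simp only [StepOn, h.getElem?, h.zero_test, h.applyOn_shift]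
  constructor
  · rintro ⟨a, ha, μ, hμ, rfl⟩
    exact ⟨_, ⟨a, ha, μ, hμ, rfl⟩, rfl⟩
  · rintro ⟨d, ⟨a, ha, μ, hμ, rfl⟩, rfl⟩
    exact ⟨a, ha, μ, hμ, rfl⟩

/-- Head and counters change by at most one, so a step costs one unit of margin. At an end of the
window that is an end of the tape no margin is needed, because the end-marker stops the head. -/
theorem Margin.step (h : Margin (b + 1) X V Y e c) (hT : X ++ V ++ Y = tape w) {d : M.Config}
    (hd : M.StepOn V c d) : Margin b X V Y e d := by
  have hlen : X.length + V.length + Y.length = w.length + 2 := by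
    rw [← length_tape, ← hT]; simp [Nat.add_assoc]
  have hd' := h.stepOn_iff.2 ⟨d, hd, rfl⟩
  rw [hT] at hd'
  have hp := h.pos_lt
  have hin := hd'.pos_le (by simp only [shift]; omega)
  simp only [shift] at hin
  obtain ⟨a, ha, μ, hμ, rfl⟩ := hd
  have h₁ := a.headMove_le c.pos μ.2.1
  have h₂ := a.le_headMove c.pos μ.2.1
  refine ⟨?_, ?_, ?_⟩
  · rcases h.left with h | h
    · exact .inl h
    · exact .inr (by simp only [applyOn]; omega)
  · rcases h.right with h | ⟨rfl, h⟩
    · exact .inl (by simp only [applyOn]; omega)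
    · exact .inr ⟨rfl, by simp only [applyOn] at hin ⊢; simp at hlen; omega⟩
  · intro i
    rcases h.counter i with h | h
    · exact .inl h
    · right
      simp only [applyOn]
      cases μ.2.2 i <;> simp <;> omega

theorem Margin.steps {n : ℕ} (h : Margin (n + b) X V Y e c) (hT : X ++ V ++ Y = tape w)
    {d : M.Config} (hd : M.StepsOn V n c d) : Margin b X V Y e d := by
  induction n generalizing c with
  | zero => cases hd; simpa using h
  | succ n ih =>
    rw [Nat.succ_add] at h
    obtain ⟨c₁, h₁, h₂⟩ := hd
    exact ih (h.step hT h₁) h₂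

theorem Margin.stepsOn_iff {n : ℕ} (h : Margin (n + b) X V Y e c) (hT : X ++ V ++ Y = tape w)
    {c' : M.Config} :
    M.StepsOn (tape w) n (shift X.length e c) c' ↔
      ∃ d, M.StepsOn V n c d ∧ c' = shift X.length e d := by
  induction n generalizing c with
  | zero => simp [StepsOn, eq_comm]
  | succ n ih =>
    rw [Nat.succ_add] at h
    have h' := fun c' => h.stepOn_iff (c' := c')
    rw [hT] at h'
    simp only [StepsOn]
    constructor
    · rintro ⟨c₁, h₁, h₂⟩
      obtain ⟨d₁, hd₁, rfl⟩ := (h' _).1 h₁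
      obtain ⟨d, hd, rfl⟩ := (ih (h.step hT hd₁)).1 h₂
      exact ⟨d, ⟨d₁, hd₁, hd⟩, rfl⟩
    · rintro ⟨d, ⟨d₁, hd₁, hd⟩, rfl⟩
      exact ⟨_, (h' _).2 ⟨d₁, hd₁, rfl⟩, (ih (h.step hT hd₁)).2 ⟨d, hd, rfl⟩⟩

theorem Margin.haltedOn_iff (h : Margin (b + 1) X V Y e c) (hT : X ++ V ++ Y = tape w) :
    M.HaltedOn (tape w) (shift X.length e c) ↔ M.HaltedOn V c := by
  simp only [HaltedOn, ← hT, h.stepOn_iff]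
  constructor
  · intro H d hd; exact H _ ⟨d, hd, rfl⟩
  · rintro H _ ⟨d, hd, rfl⟩; exact H d hd

end Window

/-- An accepting computation of fewer than `n` steps exists on `T`. -/
def AcceptsWithin (M : CounterMachine α k) (T : List (TapeSymbol α)) (n : ℕ) (c : M.Config) :
    Prop :=
  ∃ j < n, ∃ d, M.StepsOn T j c d ∧ M.HaltedOn T d ∧ d.state ∈ M.final

theorem Margin.acceptsWithin_iff {w : List α} {X V Y : List (TapeSymbol α)} {e : Fin k → ℕ}
    {n : ℕ} {c : M.Config} (h : Margin n X V Y e c) (hT : X ++ V ++ Y = tape w) :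
    M.AcceptsWithin (tape w) n (shift X.length e c) ↔ M.AcceptsWithin V n c := by
  refine exists_congr fun j => and_congr_right fun hj => ?_
  -- Strictness of `j < n` leaves one unit of margin at the last configuration, enough to compare
  -- whether a further step exists.
  obtain ⟨b, rfl⟩ : ∃ b, n = j + (b + 1) := ⟨n - j - 1, by omega⟩
  constructor
  · rintro ⟨d, h₁, h₂, h₃⟩
    obtain ⟨d, hd, rfl⟩ := (h.stepsOn_iff hT).1 h₁
    exact ⟨d, hd, ((h.steps hT hd).haltedOn_iff hT).1 h₂, h₃⟩
  · rintro ⟨d, h₁, h₂, h₃⟩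
    exact ⟨_, (h.stepsOn_iff hT).2 ⟨d, h₁, rfl⟩, ((h.steps hT h₁).haltedOn_iff hT).2 h₂, h₃⟩

end CounterMachine

/-! ### Compressed tapes as zippers with registers -/

/-- The word `D` repeated `n` times. -/
def List.repeated {γ : Type*} (n : ℕ) (D : List γ) : List γ := (List.replicate n D).flatten

namespace List

variable {γ : Type*}

@[simp] theorem repeated_zero (D : List γ) : repeated 0 D = [] := rfl

theorem repeated_succ (n : ℕ) (D : List γ) : repeated (n + 1) D = D ++ repeated n D := rfl

theorem repeated_succ' (n : ℕ) (D : List γ) : repeated (n + 1) D = repeated n D ++ D := by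
  simp [repeated, List.replicate_succ']

@[simp] theorem length_repeated (n : ℕ) (D : List γ) :
    (repeated n D).length = n * D.length := by
  simp [repeated]

end List

open List (repeated)

/-- A tape compressed as `u₀ D₁^{n₁} u₁ ⋯ Dᵣ^{nᵣ} uᵣ` together with a current cell, which is one of
the words `uᵢ` or one of the copies of `Dᵢ`. The list `before` holds the pairs `(uⱼ, Dⱼ₊₁)` with
`j < i`, the last one first, and `after` holds the pairs `(Dⱼ, uⱼ)` with `j > i`. The exponents are
kept outside, in registers numbered from `0`: the exponent of `Dⱼ` left of the current cell is in
register `j - 1`, and the one right of the current cell is in register `j`. -/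
structure TapeZipper (γ : Type*) where
  before : List (List γ × List γ)
  mid : List γ
  after : List (List γ × List γ)
  onRun : Bool

namespace TapeZipper

variable {γ : Type*}

/-- The text described by `before`. -/
def textBefore (reg : ℕ → ℕ) : List (List γ × List γ) → List γ
  | [] => []
  | (u, D) :: l => textBefore reg l ++ u ++ repeated (reg l.length) D

/-- The text described by `after`. -/
def textAfter (reg : ℕ → ℕ) : ℕ → List (List γ × List γ) → List γ
  | _, [] => []
  | i, (D, u) :: l => repeated (reg (i + 1)) D ++ u ++ textAfter reg (i + 1) l

/-- The word in the current cell. -/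
def cell : TapeZipper γ → List γ
  | ⟨(_, D) :: _, _, _, true⟩ => D
  | ⟨_, mid, _, _⟩ => mid

/-- The text left of the current cell. -/
def left (Z : TapeZipper γ) (reg : ℕ → ℕ) : List γ := textBefore reg Z.before

/-- The text right of the current cell. -/
def right (reg : ℕ → ℕ) : TapeZipper γ → List γ
  | ⟨(_, D) :: l, mid, r, true⟩ =>
    repeated (reg (l.length + 1)) D ++ mid ++ textAfter reg (l.length + 1) r
  | ⟨l, _, r, _⟩ => textAfter reg l.length r

/-- The cell to the right of the current one, and the changes of the registers when it becomes the
current one. Here `z j` tells whether register `j` is zero. -/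
def next (z : ℕ → Bool) : TapeZipper γ → Option (TapeZipper γ × (ℕ → SignType))
  | ⟨_, _, [], false⟩ => none
  | ⟨l, mid, (D, u) :: r, false⟩ =>
    if z (l.length + 1) then some (⟨(mid, D) :: l, u, r, false⟩, 0)
    else some (⟨(mid, D) :: l, u, r, true⟩, Pi.single (l.length + 1) (-1))
  | ⟨[], _, _, true⟩ => none
  | ⟨p :: l, mid, r, true⟩ =>
    if z (l.length + 1) then some (⟨p :: l, mid, r, false⟩, Pi.single l.length 1)
    else some (⟨p :: l, mid, r, true⟩,
      Function.update (Pi.single l.length 1) (l.length + 1) (-1))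

/-- The cell to the left of the current one, and the changes of the registers when it becomes the
current one. -/
def prev (z : ℕ → Bool) : TapeZipper γ → Option (TapeZipper γ × (ℕ → SignType))
  | ⟨[], _, _, _⟩ => none
  | ⟨(u, D) :: l, mid, r, false⟩ =>
    if z l.length then some (⟨l, u, (D, mid) :: r, false⟩, 0)
    else some (⟨(u, D) :: l, mid, r, true⟩, Pi.single l.length (-1))
  | ⟨(u, D) :: l, mid, r, true⟩ =>
    if z l.length then some (⟨l, u, (D, mid) :: r, false⟩, Pi.single (l.length + 1) 1)
    else some (⟨(u, D) :: l, mid, r, true⟩,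
      Function.update (Pi.single l.length (-1)) (l.length + 1) 1)

/-- All words have at least `Q` and at most `B` letters. -/
def Sized (Q B : ℕ) (Z : TapeZipper γ) : Prop :=
  (∀ p ∈ Z.before, (Q ≤ p.1.length ∧ p.1.length ≤ B) ∧ Q ≤ p.2.length ∧ p.2.length ≤ B) ∧
  (∀ p ∈ Z.after, (Q ≤ p.1.length ∧ p.1.length ≤ B) ∧ Q ≤ p.2.length ∧ p.2.length ≤ B) ∧
  Q ≤ Z.mid.length ∧ Z.mid.length ≤ B

/-- The number of runs. -/
def size (Z : TapeZipper γ) : ℕ := Z.before.length + Z.after.length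

/-- The registers are compatible with the zipper: the register in the middle is in use exactly on
a run. -/
def Fits (reg : ℕ → ℕ) (Z : TapeZipper γ) : Prop :=
  (Z.onRun = false → reg Z.before.length = 0) ∧ (Z.onRun = true → Z.before ≠ [])

/-- The effect of the changes `δ` on the registers. -/
def addReg (reg : ℕ → ℕ) (δ : ℕ → SignType) (j : ℕ) : ℕ := ((reg j : ℤ) + (δ j : ℤ)).toNat

theorem textBefore_congr {reg reg' : ℕ → ℕ} {l : List (List γ × List γ)}
    (h : ∀ j < l.length, reg j = reg' j) : textBefore reg l = textBefore reg' l := by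
  induction l with
  | nil => rfl
  | cons p l ih =>
    simp only [textBefore]
    rw [ih fun j hj => h j (by simp; omega), h l.length (by simp)]

theorem textAfter_congr {reg reg' : ℕ → ℕ} {i : ℕ} {l : List (List γ × List γ)}
    (h : ∀ j, i < j → reg j = reg' j) : textAfter reg i l = textAfter reg' i l := by
  induction l generalizing i with
  | nil => rfl
  | cons p l ih =>
    simp only [textAfter]
    rw [ih fun j hj => h j (by omega), h (i + 1) (by omega)]

theorem Sized.length_cell {Q B : ℕ} {Z : TapeZipper γ} (h : Z.Sized Q B) :
    Q ≤ Z.cell.length ∧ Z.cell.length ≤ B := by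
  obtain ⟨h₁, h₂, h₃⟩ := h
  rcases Z with ⟨_ | ⟨⟨u, D⟩, l⟩, mid, r, _ | _⟩
  · exact h₃
  · exact h₃
  · exact h₃
  · exact (h₁ (u, D) (by simp)).2

/-- The relation between a zipper and its neighbour `Z'` on the right. -/
structure Adjacent (reg reg' : ℕ → ℕ) (Z Z' : TapeZipper γ) : Prop where
  left_eq : Z'.left reg' = Z.left reg ++ Z.cell
  right_eq : Z.right reg = Z'.cell ++ Z'.right reg'

/-- The register changes `δ` never decrement a zero register and touch only registers up to `r`. -/
def Legal (reg : ℕ → ℕ) (δ : ℕ → SignType) (r : ℕ) : Prop :=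
  (∀ j, δ j = -1 → reg j ≠ 0) ∧ ∀ j, r < j → δ j = 0

section Moves

variable {reg : ℕ → ℕ} {z : ℕ → Bool} {Z Z' : TapeZipper γ} {δ : ℕ → SignType}

theorem addReg_zero : addReg reg 0 = reg := by
  funext j; simp [addReg]

theorem next_none (hf : Z.Fits reg) (h : Z.next z = none) : Z.right reg = [] := by
  rcases Z with ⟨_ | ⟨⟨u, D⟩, l⟩, mid, _ | ⟨⟨E, v⟩, r⟩, _ | _⟩ <;>
    simp_all [next, right, textAfter, Fits] <;> split at h <;> simp_all

theorem prev_none (h : Z.prev z = none) : Z.left reg = [] := by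
  rcases Z with ⟨_ | ⟨⟨u, D⟩, l⟩, mid, r, _ | _⟩
  · rfl
  · rfl
  · simp only [prev] at h; split at h <;> simp_all
  · simp only [prev] at h; split at h <;> simp_all

theorem next_sized {Q B : ℕ} (hs : Z.Sized Q B) (h : Z.next z = some (Z', δ)) :
    Z'.Sized Q B ∧ Z'.size = Z.size := by
  rcases Z with ⟨_ | ⟨⟨u, D⟩, l⟩, mid, _ | ⟨⟨E, v⟩, r⟩, _ | _⟩ <;> simp only [next] at h <;>
    try split at h
  all_goals
    first
    | cases h
      done
    | simp only [Option.some.injEq, Prod.mk.injEq] at h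
      obtain ⟨rfl, rfl⟩ := h
      simp only [Sized, size, List.forall_mem_cons, List.length_cons] at hs ⊢
      exact ⟨by tauto, by first | trivial | omega⟩

theorem prev_sized {Q B : ℕ} (hs : Z.Sized Q B) (h : Z.prev z = some (Z', δ)) :
    Z'.Sized Q B ∧ Z'.size = Z.size := by
  rcases Z with ⟨_ | ⟨⟨u, D⟩, l⟩, mid, r, _ | _⟩ <;> simp only [prev] at h <;>
    try split at h
  all_goals
    first
    | cases h
      done
    | simp only [Option.some.injEq, Prod.mk.injEq] at h
      obtain ⟨rfl, rfl⟩ := h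
      simp only [Sized, size, List.forall_mem_cons, List.length_cons] at hs ⊢
      exact ⟨by tauto, by first | trivial | omega⟩

theorem addReg_single {i j : ℕ} (s : SignType) (h : j ≠ i) :
    addReg reg (Pi.single i s) j = reg j := by
  simp [addReg, h]

theorem addReg_update {i j : ℕ} (s t : SignType) (hi : j ≠ i) (hj : j ≠ i + 1) :
    addReg reg (Function.update (Pi.single i s) (i + 1) t) j = reg j := by
  simp [addReg, hi, hj]

theorem legal_zero (r : ℕ) : Legal reg 0 r := ⟨fun j h => by simp at h, fun j _ => rfl⟩

theorem legal_single {i r : ℕ} {s : SignType} (hr : i ≤ r) (h : s = -1 → reg i ≠ 0) :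
    Legal reg (Pi.single i s) r := by
  refine ⟨fun j hj => ?_, fun j hj => ?_⟩
  · by_cases hji : j = i
    · subst hji; exact h (by simpa using hj)
    · simp [hji] at hj
  · have : j ≠ i := by omega
    simp [this]

theorem legal_update {i r : ℕ} {s t : SignType} (hr : i + 1 ≤ r) (h : s = -1 → reg i ≠ 0)
    (h' : t = -1 → reg (i + 1) ≠ 0) :
    Legal reg (Function.update (Pi.single i s) (i + 1) t) r := by
  refine ⟨fun j hj => ?_, fun j hj => ?_⟩
  · by_cases hji : j = i + 1
    · subst hji; exact h' (by simpa using hj)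
    · rw [Function.update_of_ne hji] at hj
      exact (legal_single le_rfl h).1 j hj
  · have : j ≠ i := by omega
    have : j ≠ i + 1 := by omega
    simp [*]

/-- On a word the middle register is zero, so skipping an empty run changes nothing: the zero
exponent just becomes the new middle register. Entering, continuing or leaving a run moves single
copies between the two adjacent registers, so all changes are by at most one. -/
theorem next_some (hf : Z.Fits reg) (hz : ∀ j, z j = true ↔ reg j = 0)
    (h : Z.next z = some (Z', δ)) :
    Z'.Fits (addReg reg δ) ∧ Legal reg δ Z.size ∧ Adjacent reg (addReg reg δ) Z Z' := by
  rcases Z with ⟨l, mid, r, _ | _⟩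
  · have h0 : reg l.length = 0 := hf.1 rfl
    rcases r with _ | ⟨⟨D, u⟩, r⟩
    · simp [next] at h
    simp only [next] at h
    split_ifs at h with hz'
    · simp only [Option.some.injEq, Prod.mk.injEq] at h
      obtain ⟨rfl, rfl⟩ := h
      rw [hz] at hz'
      refine ⟨⟨fun _ => by simpa [addReg_zero] using hz', by simp⟩, legal_zero _, ?_, ?_⟩
      · simp [left, textBefore, cell, addReg_zero, h0]
      · simp [right, textAfter, cell, addReg_zero, hz']
    · simp only [Option.some.injEq, Prod.mk.injEq] at h
      obtain ⟨rfl, rfl⟩ := h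
      rw [hz] at hz'
      obtain ⟨n, hn⟩ := Nat.exists_eq_succ_of_ne_zero hz'
      refine ⟨⟨by simp, by simp⟩, legal_single (by simp only [size, List.length_cons]; omega) (fun _ => hz'), ?_, ?_⟩
      · simp only [left, textBefore, cell]
        rw [addReg_single _ (by omega), h0,
          textBefore_congr (fun j hj => addReg_single _ (by omega))]
        simp
      · simp only [right, textAfter, cell]
        rw [textAfter_congr (reg' := reg) (i := l.length + 1)
          (fun j hj => addReg_single _ (by omega)), hn]
        simp [addReg, hn, List.repeated_succ]
  · rcases l with _ | ⟨⟨u, D⟩, l⟩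
    · simp [next] at h
    simp only [next] at h
    split_ifs at h with hz'
    · simp only [Option.some.injEq, Prod.mk.injEq] at h
      obtain ⟨rfl, rfl⟩ := h
      rw [hz] at hz'
      refine ⟨⟨fun _ => ?_, by simp⟩, legal_single (by simp only [size, List.length_cons]; omega) (by simp), ?_, ?_⟩
      · simpa using (addReg_single _ (by simp)).trans hz'
      · simp only [left, textBefore, cell]
        rw [textBefore_congr (reg' := reg) (l := l) (fun j hj => addReg_single _ (by omega))]
        simp [addReg, Int.toNat_add, List.repeated_succ']
      · simp only [right, cell, List.length_cons]
        rw [textAfter_congr (reg := addReg reg (Pi.single l.length 1)) (reg' := reg)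
          (fun j hj => addReg_single _ (by omega)), hz']
        simp
    · simp only [Option.some.injEq, Prod.mk.injEq] at h
      obtain ⟨rfl, rfl⟩ := h
      rw [hz] at hz'
      obtain ⟨n, hn⟩ := Nat.exists_eq_succ_of_ne_zero hz'
      refine ⟨⟨by simp, by simp⟩, legal_update (by simp only [size, List.length_cons]; omega) (by simp)
        (fun _ => hz'), ?_, ?_⟩
      · simp only [left, textBefore, cell]
        rw [textBefore_congr (reg' := reg) (l := l)
          (fun j hj => addReg_update _ _ (by omega) (by omega))]
        simp [addReg, Int.toNat_add, List.repeated_succ']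
      · simp only [right, cell]
        rw [textAfter_congr (reg' := reg) (i := l.length + 1)
          (fun j hj => addReg_update _ _ (by omega) (by omega)), hn]
        simp [addReg, hn, List.repeated_succ]

theorem prev_some (hf : Z.Fits reg) (hz : ∀ j, z j = true ↔ reg j = 0)
    (h : Z.prev z = some (Z', δ)) :
    Z'.Fits (addReg reg δ) ∧ Legal reg δ Z.size ∧ Adjacent (addReg reg δ) reg Z' Z := by
  rcases Z with ⟨_ | ⟨⟨u, D⟩, l⟩, mid, r, _ | _⟩
  · simp [prev] at h
  · simp [prev] at h
  · have h0 : reg (l.length + 1) = 0 := hf.1 rfl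
    simp only [prev] at h
    split_ifs at h with hz'
    · simp only [Option.some.injEq, Prod.mk.injEq] at h
      obtain ⟨rfl, rfl⟩ := h
      rw [hz] at hz'
      refine ⟨⟨fun _ => by simpa [addReg_zero] using hz', by simp⟩, legal_zero _, ?_, ?_⟩
      · simp [left, textBefore, cell, addReg_zero, hz']
      · simp [right, textAfter, cell, addReg_zero, h0]
    · simp only [Option.some.injEq, Prod.mk.injEq] at h
      obtain ⟨rfl, rfl⟩ := h
      rw [hz] at hz'
      obtain ⟨n, hn⟩ := Nat.exists_eq_succ_of_ne_zero hz'
      refine ⟨⟨by simp, by simp⟩, legal_single (by simp only [size, List.length_cons]; omega) (fun _ => hz'), ?_, ?_⟩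
      · simp only [left, textBefore, cell]
        rw [textBefore_congr (reg' := reg) (l := l) (fun j hj => addReg_single _ (by omega))]
        simp [addReg, hn, List.repeated_succ']
      · simp only [right, cell, List.length_cons]
        rw [textAfter_congr (reg' := reg) (i := l.length + 1)
          (fun j hj => addReg_single _ (by omega)), addReg_single _ (by omega), h0]
        simp
  · simp only [prev] at h
    split_ifs at h with hz'
    · simp only [Option.some.injEq, Prod.mk.injEq] at h
      obtain ⟨rfl, rfl⟩ := h
      rw [hz] at hz'
      refine ⟨⟨fun _ => ?_, by simp⟩, legal_single (by simp only [size, List.length_cons]; omega) (by simp), ?_, ?_⟩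
      · simpa using (addReg_single _ (by simp)).trans hz'
      · simp only [left, textBefore, cell]
        rw [textBefore_congr (reg' := reg) (l := l) (fun j hj => addReg_single _ (by omega)), hz']
        simp
      · simp only [right, textAfter, cell]
        rw [textAfter_congr (reg' := reg) (i := l.length + 1)
          (fun j hj => addReg_single _ (by omega))]
        simp [addReg, Int.toNat_add, List.repeated_succ]
    · simp only [Option.some.injEq, Prod.mk.injEq] at h
      obtain ⟨rfl, rfl⟩ := h
      rw [hz] at hz'
      obtain ⟨n, hn⟩ := Nat.exists_eq_succ_of_ne_zero hz'
      refine ⟨⟨by simp, by simp⟩, legal_update (by simp only [size, List.length_cons]; omega) (fun _ => hz')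
        (by simp), ?_, ?_⟩
      · simp only [left, textBefore, cell]
        rw [textBefore_congr (reg' := reg) (l := l)
          (fun j hj => addReg_update _ _ (by omega) (by omega))]
        simp [addReg, hn, List.repeated_succ']
      · simp only [right, cell]
        rw [textAfter_congr (reg' := reg) (i := l.length + 1)
          (fun j hj => addReg_update _ _ (by omega) (by omega))]
        simp [addReg, Int.toNat_add, List.repeated_succ]

end Moves

/-- Move the focus of a zipper that is not on a run to the first word. -/
def rewind : List (List γ × List γ) → List γ → List (List γ × List γ) → TapeZipper γ
  | [], mid, r => ⟨[], mid, r, false⟩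
  | (u, D) :: l, mid, r => rewind l u ((D, mid) :: r)

theorem rewind_left (l : List (List γ × List γ)) (mid : List γ)
    (r : List (List γ × List γ)) :
    (rewind l mid r).before = [] ∧ (rewind l mid r).onRun = false := by
  induction l generalizing mid r with
  | nil => exact ⟨rfl, rfl⟩
  | cons p l ih => exact ih _ _

/-- The exponent that the parser numbers `j` is stored in register `j + 1`, which is its register
once it lies to the right of the focus. Rewinding therefore needs no transfer between registers. -/
theorem rewind_text (reg : ℕ → ℕ) (l : List (List γ × List γ)) (mid : List γ)
    (r : List (List γ × List γ)) :
    (rewind l mid r).cell ++ (rewind l mid r).right reg =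
      textBefore (fun j => reg (j + 1)) l ++ mid ++ textAfter reg l.length r := by
  induction l generalizing mid r with
  | nil => rfl
  | cons p l ih => simp [rewind, ih, textBefore, textAfter]

theorem rewind_sized {Q B : ℕ} (l : List (List γ × List γ)) (mid : List γ)
    (r : List (List γ × List γ)) (h : Sized Q B ⟨l, mid, r, false⟩) :
    (rewind l mid r).Sized Q B ∧ (rewind l mid r).size = l.length + r.length := by
  induction l generalizing mid r with
  | nil => exact ⟨h, rfl⟩
  | cons p l ih =>
    obtain ⟨h₁, h₂⟩ := ih p.1 ((p.2, mid) :: r) (by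
      simp only [Sized, List.forall_mem_cons] at h ⊢; tauto)
    exact ⟨h₁, by simp only [rewind, h₂, List.length_cons]; omega⟩

/-- Register `0` counts disjoint copies of a nonempty word left of the current cell, or is zero if
nothing lies to the left. Hence the input head can hold it. -/
theorem reg_zero_lt {Q B : ℕ} (hQ : 1 ≤ Q) {Z : TapeZipper γ} {reg : ℕ → ℕ} (hs : Z.Sized Q B)
    (hf : Z.Fits reg) : reg 0 < (Z.left reg ++ Z.cell ++ Z.right reg).length := by
  have hc := hs.length_cell
  rcases Z with ⟨l, mid, r, b⟩
  have key : ∀ l : List (List γ × List γ), l ≠ [] → (∀ p ∈ l, Q ≤ p.2.length) →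
      reg 0 ≤ (textBefore reg l).length := by
    intro l
    induction l with
    | nil => simp
    | cons p l ih =>
      intro _ h
      rw [List.forall_mem_cons] at h
      rcases l with _ | ⟨p', l⟩
      · simp only [textBefore, List.length_append, List.length_repeated, List.length_nil]
        have := Nat.le_mul_of_pos_right (reg 0) (show 0 < p.2.length by omega)
        omega
      · have := ih (by simp) h.2
        rw [textBefore]
        simp only [List.length_append] at this ⊢
        omega
  simp only [List.length_append]
  by_cases hl : l = []
  · subst hl
    have : b = false := by
      by_contra h
      exact hf.2 (by simpa using h) rfl
    have := hf.1 this
    simp only [List.length_nil] at this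
    omega
  · have := key l hl fun p hp => (hs.1 p hp).2.1
    simp only [left]
    omega

end TapeZipper

/-! ### Compressing the input while reading it -/

namespace TapeParser

open TapeZipper

variable {γ : Type*}

/-- The word `x` consists of two copies of the last repeated word. -/
def Extends : List (List γ × List γ) → List γ → Prop
  | [], _ => False
  | p :: _, x => x = p.2 ++ p.2

open Classical in
/-- One step of the parser that compresses a text as `u₀ D₁^{n₁} u₁ ⋯ Dᵣ^{nᵣ} x`, where all the
words `Dᵢ` have `Q` letters. The first component of its state holds the pairs `(uᵢ, Dᵢ₊₁)`, the
last one first, the second one is `x`. The result of the step is the new state and the change of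
the exponents. -/
noncomputable def absorb (Q : ℕ) (F : List (List γ × List γ) × List γ) (a : γ) :
    (List (List γ × List γ) × List γ) × (ℕ → SignType) :=
  if Extends F.1 (F.2 ++ [a]) then
    ((F.1, (F.2 ++ [a]).drop Q), Pi.single (F.1.length - 1) 1)
  else if h : ∃ p : List γ × List γ, p.2.length = Q ∧ F.2 ++ [a] = p.1 ++ p.2 ++ p.2 ++ p.2 then
    (((h.choose.1 ++ h.choose.2 ++ h.choose.2, h.choose.2) :: F.1, h.choose.2), 0)
  else ((F.1, F.2 ++ [a]), 0)

/-- The parser state `F` with exponents `N` describes the text `X`. -/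
structure Describes (Q : ℕ) (X : List γ) (F : List (List γ × List γ) × List γ) (N : ℕ → ℕ) :
    Prop where
  text : X = textBefore N F.1 ++ F.2
  fresh : ∀ j, F.1.length ≤ j → N j = 0
  length_pair : ∀ p ∈ F.1, Q ≤ p.1.length ∧ p.2.length = Q
  length_rest : Q ≤ F.2.length

variable {Q : ℕ}

/-- The three ways the parser can proceed. -/
theorem absorb_cases (F : List (List γ × List γ) × List γ) (a : γ)
    (hF : ∀ p ∈ F.1, p.2.length = Q) :
    (∃ u D l, F.1 = (u, D) :: l ∧ F.2 ++ [a] = D ++ D ∧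
      absorb Q F a = ((F.1, D), Pi.single l.length 1)) ∨
    (¬ Extends F.1 (F.2 ++ [a]) ∧ ∃ v E, E.length = Q ∧ F.2 ++ [a] = v ++ E ++ E ++ E ∧
      absorb Q F a = (((v ++ E ++ E, E) :: F.1, E), 0)) ∨
    (¬ Extends F.1 (F.2 ++ [a]) ∧ (∀ v E, E.length = Q → F.2 ++ [a] ≠ v ++ E ++ E ++ E) ∧
      absorb Q F a = ((F.1, F.2 ++ [a]), 0)) := by
  by_cases h : Extends F.1 (F.2 ++ [a])
  · left
    obtain ⟨l, x⟩ := F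
    rcases l with _ | ⟨⟨u, D⟩, l⟩
    · exact h.elim
    · refine ⟨u, D, l, rfl, h, ?_⟩
      have hD : D.length = Q := hF (u, D) (by simp)
      have hx : x ++ [a] = D ++ D := h
      rw [absorb, if_pos h]
      simp [hx, ← hD]
  · right
    by_cases h' : ∃ p : List γ × List γ, p.2.length = Q ∧ F.2 ++ [a] = p.1 ++ p.2 ++ p.2 ++ p.2
    · left
      refine ⟨h, _, _, h'.choose_spec.1, h'.choose_spec.2, ?_⟩
      rw [absorb, if_neg h, dif_pos h']
    · right
      refine ⟨h, fun v E hE he => h' ⟨(v, E), hE, he⟩, ?_⟩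
      rw [absorb, if_neg h, dif_neg h']

theorem Describes.absorb {X : List γ} {F : List (List γ × List γ) × List γ} {N : ℕ → ℕ}
    (h : Describes Q X F N) (a : γ) :
    Describes Q (X ++ [a]) (absorb Q F a).1 (addReg N (absorb Q F a).2) := by
  obtain ⟨l, x⟩ := F
  rcases absorb_cases (l, x) a (fun p hp => (h.length_pair p hp).2) with
    ⟨u, D, l, hl, hx, he⟩ | ⟨-, v, E, hE, hx, he⟩ | ⟨-, -, he⟩
  · dsimp only at hl hx he
    subst hl
    have hD := (h.length_pair (u, D) (by simp)).2
    rw [he]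
    refine ⟨?_, fun j hj => ?_, h.length_pair, hD.ge⟩
    · have hb : textBefore (addReg N (Pi.single l.length 1)) l = textBefore N l :=
        textBefore_congr fun j hj => addReg_single _ (by omega)
      rw [h.text]
      simp only [List.append_assoc, hx, textBefore, hb]
      simp [addReg, Int.toNat_add, List.repeated_succ']
    · simp only [List.length_cons] at hj
      rw [addReg_single _ (by omega)]
      exact h.fresh j (by simpa using hj)
  · dsimp only at hx he
    rw [he, addReg_zero]
    refine ⟨?_, fun j hj => h.fresh j (by simp at hj ⊢; omega), ?_, hE.ge⟩
    · simp only [textBefore]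
      rw [h.fresh l.length le_rfl, h.text]
      simp [hx]
    · rw [List.forall_mem_cons]
      exact ⟨⟨by simp; omega, hE⟩, h.length_pair⟩
  · rw [he, addReg_zero]
    exact ⟨by rw [h.text]; simp, h.fresh, h.length_pair, by have := h.length_rest; simp at this ⊢; omega⟩

/-! ### Bounds on nearly periodic texts -/

/-- A text that, apart from its first letter, repeats with period `Q` unless one of the positions
in `S` interferes. -/
def NearlyPeriodic (Q : ℕ) (S : Finset ℕ) (T : List γ) : Prop :=
  ∀ x, 1 ≤ x → x < T.length → (∀ b ∈ S, b + Q ≤ x ∨ x < b) → Q + 1 ≤ x ∧ T[x]? = T[x - Q]?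

theorem NearlyPeriodic.of_append {S : Finset ℕ} {T T' : List γ}
    (h : NearlyPeriodic Q S (T ++ T')) : NearlyPeriodic Q S T := by
  intro x h₁ h₂ h₃
  have := h x h₁ (by simp; omega) h₃
  rwa [List.getElem?_append_left h₂, List.getElem?_append_left (by omega)] at this

theorem exists_cube {l : List γ} {t : ℕ} (hl : t + 3 * Q ≤ l.length)
    (h : ∀ y, t + Q ≤ y → y < t + 3 * Q → l[y]? = l[y - Q]?) :
    ∃ v E x, v.length = t ∧ E.length = Q ∧ l = v ++ E ++ E ++ E ++ x := by
  have key : ∀ s, t ≤ s → s < t + 2 * Q → s + 2 * Q ≤ t + 3 * Q →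
      (l.drop (s + Q)).take Q = (l.drop s).take Q := by
    intro s h₁ h₂ h₃
    refine List.ext_getElem? fun j => ?_
    simp only [List.getElem?_take, List.getElem?_drop]
    split_ifs with hj
    · rw [h (s + Q + j) (by omega) (by omega)]
      congr 1; omega
    · rfl
  refine ⟨l.take t, (l.drop t).take Q, l.drop (t + 3 * Q), by simp; omega, by simp; omega, ?_⟩
  rcases Nat.eq_zero_or_pos Q with rfl | hQ
  · simp
  have e₁ := key t le_rfl (by omega) (by omega)
  have e₂ := key (t + Q) (by omega) (by omega) (by omega)
  have d : ∀ s, l.drop s = (l.drop s).take Q ++ l.drop (s + Q) := fun s => by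
    rw [← List.drop_drop, List.take_append_drop]
  conv_lhs => rw [← List.take_append_drop t l, d t, d (t + Q), d (t + Q + Q), e₂, e₁]
  simp only [List.append_assoc]
  congr 5
  omega

/-- Bounds on the parser state that hold for nearly periodic texts. -/
structure Bounded (Q H B : ℕ) (S : Finset ℕ) (F : List (List γ × List γ) × List γ) (N : ℕ → ℕ) :
    Prop where
  card : F.1.length ≤ (S.filter (· ≤ (textBefore N F.1).length)).card
  maximal : ∀ p l, F.1 = p :: l → ∃ x, F.2 = p.2 ++ x ∧ ¬ p.2 <+: x
  cube_free : ∀ v E x, E.length = Q → F.2 = v ++ E ++ E ++ E ++ x → v.length < H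
  length_word : ∀ p ∈ F.1, p.1.length ≤ B

variable {X : List γ} {F : List (List γ × List γ) × List γ} {N : ℕ → ℕ} {H B : ℕ} {S : Finset ℕ}

/-- Pigeonhole: a longer rest has room, after its first `H` letters, for `S.card + 1` disjoint
blocks of length `3 * Q`. One of them has no point of `S` strictly inside, so it is a cube, against
`cube_free`. -/
theorem Bounded.length_rest (hQ : 1 ≤ Q) (hH : 1 ≤ H) (hb : Bounded Q H B S F N)
    (hd : Describes Q X F N) (hX : NearlyPeriodic Q S X) :
    F.2.length < H + 3 * Q * (S.card + 1) := by
  by_contra! hlen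
  set e := (textBefore N F.1).length with he
  have hXlen : X.length = e + F.2.length := by rw [hd.text]; simp [he]
  by_cases hex : ∃ i < S.card + 1, ∀ b ∈ S,
      b ≤ e + H + 3 * Q * i ∨ e + H + 3 * Q * i + 3 * Q ≤ b
  · obtain ⟨i, hi, hS⟩ := hex
    have hi' : 3 * Q * i + 3 * Q ≤ 3 * Q * (S.card + 1) := by
      rw [← Nat.mul_succ]; exact Nat.mul_le_mul_left _ hi
    obtain ⟨v, E, x, hv, hE, h⟩ := exists_cube (l := F.2) (t := H + 3 * Q * i) (Q := Q)
      (by omega) (fun y h₁ h₂ => by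
        have := (hX (e + y) (by omega) (by omega) (fun b hb => by
          rcases hS b hb with h | h <;> omega)).2
        rw [hd.text, List.getElem?_append_right (by omega),
          List.getElem?_append_right (by omega)] at this
        simpa [← he, show e + y - Q - e = y - Q by omega] using this)
    have := hb.cube_free v E x hE h
    omega
  · push Not at hex
    choose! f hfS hf using hex
    have := Finset.card_le_card_of_injOn (s := Finset.range (S.card + 1)) (t := S) f
      (fun i hi => hfS i (by simpa using hi)) (fun i hi j hj hij => by
        have h₁ := hf i (by simpa using hi)
        have h₂ := hf j (by simpa using hj)
        rw [hij] at h₁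
        rcases lt_trichotomy i j with h | h | h
        · have := Nat.mul_le_mul_left (3 * Q) (Nat.succ_le_of_lt h)
          rw [Nat.mul_succ] at this
          omega
        · exact h
        · have := Nat.mul_le_mul_left (3 * Q) (Nat.succ_le_of_lt h)
          rw [Nat.mul_succ] at this
          omega)
    simp at this

/-- The point is the count of runs when a cube opens a new one. If no point of `S` lay between the
end of the last run and the end of the new `u`, periodicity would make the rest begin with `D D`,
and the last run would have been extended instead. -/
theorem Bounded.absorb (hQ : 1 ≤ Q) (hH : 1 ≤ H) (hB : H + 3 * Q * (S.card + 1) ≤ B)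
    (hb : Bounded Q H B S F N) (hd : Describes Q X F N) {a : γ}
    (hX : NearlyPeriodic Q S (X ++ [a])) :
    Bounded Q H B S (absorb Q F a).1 (addReg N (absorb Q F a).2) := by
  have hrest := hb.length_rest hQ hH hd hX.of_append
  obtain ⟨l, x⟩ := F
  rcases absorb_cases (l, x) a (fun p hp => (hd.length_pair p hp).2) with
    ⟨u, D, l, hl, hx, he⟩ | ⟨hext, v, E, hE, hx, he⟩ | ⟨hext, hno, he⟩
  · dsimp only at hl hx he
    subst hl
    have hD := (hd.length_pair (u, D) (by simp)).2
    dsimp only at hD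
    rw [he]
    have hbef : textBefore (addReg N (Pi.single l.length 1)) l = textBefore N l :=
        textBefore_congr fun j hj => addReg_single _ (by omega)
    refine ⟨hb.card.trans (Finset.card_le_card fun b hb => ?_), ?_, ?_, hb.length_word⟩
    · simp only [Finset.mem_filter] at hb ⊢
      refine ⟨hb.1, hb.2.trans ?_⟩
      simp only [textBefore, hbef]
      simp [addReg, Int.toNat_add, List.repeated_succ']
    · intro p l' hp
      simp only [List.cons.injEq] at hp
      obtain ⟨rfl, rfl⟩ := hp
      refine ⟨[], by simp, ?_⟩
      intro h
      have := h.length_le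
      simp only [List.length_nil] at this
      omega
    · intro v E y hE hy
      have := congrArg List.length hy
      simp only [List.length_append] at this
      omega
  · dsimp only at hx he
    rw [he, addReg_zero]
    have hxlen := congrArg List.length hx
    simp only [List.length_append, List.length_singleton] at hxlen
    have hXlen : (X ++ [a]).length = (textBefore N l).length + (x.length + 1) := by
      rw [hd.text]; simp
    have hbnd : ∃ b ∈ S, (textBefore N l).length < b ∧
        b ≤ (textBefore N l).length + v.length + Q + Q := by
      by_contra! hno
      have hper : ∀ j < Q, Q + 1 ≤ (textBefore N l).length + Q + j ∧
          (X ++ [a])[(textBefore N l).length + Q + j]? =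
            (X ++ [a])[(textBefore N l).length + j]? := fun j hj => by
        have := hX ((textBefore N l).length + Q + j) (by omega) (by omega) (fun b hb => by
          rcases Nat.lt_or_ge (textBefore N l).length b with h | h
          · have := hno b hb h
            omega
          · omega)
        rwa [show (textBefore N l).length + Q + j - Q = (textBefore N l).length + j by omega]
          at this
      -- With no earlier run, position `Q` would be undisturbed, whereas `NearlyPeriodic` puts
      -- undisturbed positions beyond `Q`. So the first run is charged to a point of `S` as well.
      rcases l with _ | ⟨p, l⟩
      · have := (hper 0 (by omega)).1
        simp [textBefore] at this
      · obtain ⟨y, hy, hny⟩ := hb.maximal p l rfl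
        dsimp only at hy
        have hp := (hd.length_pair p (by simp)).2
        have hylen := congrArg List.length hy
        simp only [List.length_append] at hylen
        apply hny
        rw [List.prefix_iff_getElem?]
        intro j hj
        have hg : ∀ i, (X ++ [a])[(textBefore N (p :: l)).length + i]? =
            (p.2 ++ (y ++ [a]))[i]? := fun i => by
          rw [hd.text]
          simp only [hy, List.append_assoc]
          rw [List.getElem?_append_right (by omega), Nat.add_sub_cancel_left]
        have := (hper j (by omega)).2
        rw [Nat.add_assoc, hg, hg, List.getElem?_append_left hj,
          List.getElem?_append_right (by omega), List.getElem?_append_left (by omega),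
          show Q + j - p.2.length = j by omega, List.getElem?_eq_getElem hj] at this
        exact this
    obtain ⟨b, hbS, hb₁, hb₂⟩ := hbnd
    refine ⟨?_, ?_, ?_, ?_⟩
    · have hlt : (S.filter (· ≤ (textBefore N l).length)).card <
          (S.filter (· ≤ (textBefore N ((v ++ E ++ E, E) :: l)).length)).card := by
        apply Finset.card_lt_card
        rw [Finset.ssubset_iff_of_subset]
        · refine ⟨b, ?_, by simp; omega⟩
          simp only [Finset.mem_filter, textBefore, List.length_append]
          refine ⟨hbS, ?_⟩
          omega
        · intro c hc
          simp only [Finset.mem_filter, textBefore, List.length_append] at hc ⊢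
          exact ⟨hc.1, by omega⟩
      have := hb.card
      simp only [List.length_cons] at this ⊢
      omega
    · intro p l' hp
      simp only [List.cons.injEq] at hp
      obtain ⟨rfl, rfl⟩ := hp
      refine ⟨[], by simp, ?_⟩
      intro h
      have := h.length_le
      simp only [List.length_nil] at this
      omega
    · intro v E y hE hy
      have := congrArg List.length hy
      simp only [List.length_append] at this
      omega
    · rw [List.forall_mem_cons]
      refine ⟨?_, hb.length_word⟩
      simp only [List.length_append]
      dsimp only at hrest
      omega
  · rw [he, addReg_zero]
    refine ⟨hb.card, ?_, ?_, hb.length_word⟩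
    · intro p l' hp
      dsimp only at hp hext
      subst hp
      obtain ⟨y, hy, hny⟩ := hb.maximal p l' rfl
      dsimp only at hy
      refine ⟨y ++ [a], by simp [hy], fun h => ?_⟩
      -- A second copy of `D` can only be completed by the letter `a`, and then the extension rule
      -- would have applied.
      rcases List.prefix_concat_iff.1 h with h | h
      · exact hext (by simp only [Extends, hy, List.append_assoc]; rw [← h])
      · exact hny h
    · intro v E y hE hy
      rcases List.eq_nil_or_concat y with rfl | ⟨y, c, rfl⟩
      · exact (hno v E hE (by simpa using hy)).elim
      · refine hb.cube_free v E y hE ?_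
        dsimp only at hy ⊢
        rw [List.concat_eq_append, ← List.append_assoc] at hy
        exact (List.append_inj' hy rfl).1

/-! ### Words of a bounded language -/

theorem repeated_getElem? (u : List γ) (n x : ℕ) (hx : x < n * u.length) :
    (repeated n u)[x]? = u[x % u.length]? := by
  induction n generalizing x with
  | zero => simp at hx
  | succ n ih =>
    rw [List.repeated_succ]
    rcases Nat.lt_or_ge x u.length with h | h
    · rw [List.getElem?_append_left h, Nat.mod_eq_of_lt h]
    · rw [List.getElem?_append_right h, ih _ (by rw [Nat.succ_mul] at hx; omega),
        Nat.mod_eq_sub_mod h]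

/-- `S` consists of the starting points of the blocks `wᵢ^{nᵢ}`. Inside a block the text has period
`|wᵢ|`, hence period `Q` from `Q` letters after its start. -/
theorem exists_boundaries {α : Type*} (ws : List (List α)) (hQ : ∀ u ∈ ws, u ≠ [] → u.length ∣ Q)
    (w : List α) (hw : w ∈ boundLanguage ws) :
    ∃ S : Finset ℕ, S.card ≤ ws.length ∧ ∀ x < w.length, (∀ b ∈ S, b + Q ≤ x ∨ x < b) →
      Q ≤ x ∧ w[x]? = w[x - Q]? := by
  induction ws generalizing w with
  | nil =>
    have : w = [] := by simpa [boundLanguage, Language.mem_one] using hw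
    exact ⟨∅, by simp, by simp [this]⟩
  | cons u ws ih =>
    rw [List.forall_mem_cons] at hQ
    simp only [boundLanguage, List.map_cons, List.prod_cons, Language.mem_mul] at hw
    obtain ⟨y, hy, v, hv, rfl⟩ := hw
    obtain ⟨S, hS, hS'⟩ := ih hQ.2 v hv
    obtain ⟨L, rfl, hL⟩ := Language.mem_kstar.1 hy
    have hL' : L.flatten = repeated L.length u := by
      rw [repeated, ← List.eq_replicate_of_mem hL]
    rw [hL']
    refine ⟨insert 0 (S.image (· + (repeated L.length u).length)), ?_, ?_⟩
    · refine (Finset.card_insert_le _ _).trans ?_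
      have := (Finset.card_image_le (s := S) (f := (· + (repeated L.length u).length))).trans hS
      simpa using this
    · intro x hx hb
      simp only [Finset.mem_insert, Finset.mem_image, forall_eq_or_imp, forall_exists_index,
        and_imp, forall_apply_eq_imp_iff₂] at hb
      rw [List.length_append] at hx
      rcases Nat.lt_or_ge x (repeated L.length u).length with h | h
      · have hQx : Q ≤ x := by omega
        refine ⟨hQx, ?_⟩
        rw [List.getElem?_append_left h, List.getElem?_append_left (by omega)]
        rw [List.length_repeated] at h
        have hu : u ≠ [] := by rintro rfl; simp at h
        rw [repeated_getElem? _ _ _ h, repeated_getElem? _ _ _ (by omega)]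
        obtain ⟨q, rfl⟩ := hQ.1 hu
        rw [← Nat.sub_mul_mod hQx]
      · obtain ⟨h₁, h₂⟩ := hS' (x - (repeated L.length u).length) (by omega) (fun b hb' => by
          have := hb.2 b hb'
          omega)
        refine ⟨by omega, ?_⟩
        rw [List.getElem?_append_right h, List.getElem?_append_right (by omega), h₂]
        congr 1
        omega

theorem exists_nearlyPeriodic {α : Type*} (ws : List (List α))
    (hQ : ∀ u ∈ ws, u ≠ [] → u.length ∣ Q) (w : List α) (hw : w ∈ boundLanguage ws) :
    ∃ S : Finset ℕ, S.card ≤ ws.length ∧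
      NearlyPeriodic Q S (TapeSymbol.left :: w.map TapeSymbol.letter) := by
  obtain ⟨S, hS, hS'⟩ := exists_boundaries ws hQ w hw
  refine ⟨S.image (· + 1), Finset.card_image_le.trans hS, ?_⟩
  intro x hx₁ hx hb
  simp only [Finset.mem_image, forall_exists_index, and_imp, forall_apply_eq_imp_iff₂] at hb
  simp only [List.length_cons, List.length_map] at hx
  obtain ⟨x, rfl⟩ : ∃ y, x = y + 1 := ⟨x - 1, by omega⟩
  obtain ⟨h₁, h₂⟩ := hS' x (by omega) (fun b hb' => by have := hb b hb'; omega)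
  refine ⟨by omega, ?_⟩
  rw [show x + 1 - Q = x - Q + 1 by omega]
  simp [h₂]

end TapeParser

/-! ### The current cell and its neighbours -/

namespace TapeZipper

variable {γ : Type*}

/-- The word in the cell left of the current one, if there is such a cell. -/
def prevCell (z : ℕ → Bool) (Z : TapeZipper γ) : List γ := (Z.prev z).elim [] fun r => r.1.cell

/-- The word in the cell right of the current one, if there is such a cell. -/
def nextCell (z : ℕ → Bool) (Z : TapeZipper γ) : List γ := (Z.next z).elim [] fun r => r.1.cell

/-- The current cell with its two neighbours. -/
def window (z : ℕ → Bool) (Z : TapeZipper γ) : List γ := Z.prevCell z ++ Z.cell ++ Z.nextCell z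

/-- The zipper for the cell that contains position `p` of the window, the change of the registers,
and the position in the cell. -/
def relocate (z : ℕ → Bool) (Z : TapeZipper γ) (p : ℕ) : TapeZipper γ × (ℕ → SignType) × ℕ :=
  if p < (Z.prevCell z).length then
    (((Z.prev z).getD (Z, 0)).1, ((Z.prev z).getD (Z, 0)).2, p)
  else if p < (Z.prevCell z).length + Z.cell.length then (Z, 0, p - (Z.prevCell z).length)
  else (((Z.next z).getD (Z, 0)).1, ((Z.next z).getD (Z, 0)).2,
    p - (Z.prevCell z).length - Z.cell.length)

/-- With the given registers, the zipper `Z` represents the text `T`, and `off` is a position in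
its current cell. -/
structure Represents (Q B m : ℕ) (T : List γ) (reg : ℕ → ℕ) (Z : TapeZipper γ) (off : ℕ) :
    Prop where
  fits : Z.Fits reg
  sized : Z.Sized Q B
  size_le : Z.size ≤ m
  text : Z.left reg ++ Z.cell ++ Z.right reg = T
  off_lt : off < Z.cell.length

/-- A neighbour is missing only at an end of the tape, and otherwise has at least `Q` letters: this
is the margin for the head. Refocusing on any cell of the window is one legal change of registers.
-/
theorem Represents.window {Q B m : ℕ} {T : List γ} {reg : ℕ → ℕ} {Z : TapeZipper γ} {off : ℕ}
    (h : Represents Q B m T reg Z off) {z : ℕ → Bool} (hz : ∀ j, z j = true ↔ reg j = 0) :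
    ∃ X Y, X ++ Z.window z ++ Y = T ∧ (X = [] ∨ Q ≤ (Z.prevCell z).length) ∧
      (Y = [] ∨ Q ≤ (Z.nextCell z).length) ∧
      (Z.left reg).length = X.length + (Z.prevCell z).length ∧
      ∀ p < (Z.window z).length,
        Legal reg (Z.relocate z p).2.1 m ∧
        Represents Q B m T (addReg reg (Z.relocate z p).2.1) (Z.relocate z p).1
          (Z.relocate z p).2.2 ∧
        ((Z.relocate z p).1.left (addReg reg (Z.relocate z p).2.1)).length +
          (Z.relocate z p).2.2 = X.length + p := by
  obtain ⟨X, hX, hX', hXp⟩ : ∃ X, Z.left reg = X ++ Z.prevCell z ∧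
      (X = [] ∨ Q ≤ (Z.prevCell z).length) ∧ ∀ p < (Z.prevCell z).length,
        Legal reg ((Z.prev z).getD (Z, 0)).2 m ∧
        Represents Q B m T (addReg reg ((Z.prev z).getD (Z, 0)).2) ((Z.prev z).getD (Z, 0)).1 p ∧
        ((Z.prev z).getD (Z, 0)).1.left (addReg reg ((Z.prev z).getD (Z, 0)).2) = X := by
    rcases hp : Z.prev z with _ | ⟨Z', δ⟩
    · exact ⟨[], by simp [prevCell, hp, prev_none hp], .inl rfl, by simp [prevCell, hp]⟩
    · obtain ⟨h₁, h₂, h₃⟩ := prev_some h.fits hz hp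
      obtain ⟨h₄, h₅⟩ := prev_sized h.sized hp
      refine ⟨Z'.left (addReg reg δ), by simp [prevCell, hp, h₃.left_eq],
        .inr (by simpa [prevCell, hp] using h₄.length_cell.1), fun p hpl => ?_⟩
      refine ⟨⟨h₂.1, fun j hj => h₂.2 j (h.size_le.trans_lt hj)⟩,
        ⟨h₁, h₄, h₅.trans_le h.size_le, ?_, by simpa [prevCell, hp] using hpl⟩, rfl⟩
      rw [← h.text, h₃.left_eq]
      simp [h₃.right_eq]
  obtain ⟨Y, hY, hY', hYp⟩ : ∃ Y, Z.right reg = Z.nextCell z ++ Y ∧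
      (Y = [] ∨ Q ≤ (Z.nextCell z).length) ∧ ∀ p < (Z.nextCell z).length,
        Legal reg ((Z.next z).getD (Z, 0)).2 m ∧
        Represents Q B m T (addReg reg ((Z.next z).getD (Z, 0)).2) ((Z.next z).getD (Z, 0)).1 p ∧
        ((Z.next z).getD (Z, 0)).1.left (addReg reg ((Z.next z).getD (Z, 0)).2) =
          Z.left reg ++ Z.cell := by
    rcases hp : Z.next z with _ | ⟨Z', δ⟩
    · exact ⟨[], by simp [nextCell, hp, next_none h.fits hp], .inl rfl, by simp [nextCell, hp]⟩
    · obtain ⟨h₁, h₂, h₃⟩ := next_some h.fits hz hp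
      obtain ⟨h₄, h₅⟩ := next_sized h.sized hp
      refine ⟨Z'.right (addReg reg δ), by simp [nextCell, hp, h₃.right_eq],
        .inr (by simpa [nextCell, hp] using h₄.length_cell.1), fun p hpl => ?_⟩
      refine ⟨⟨h₂.1, fun j hj => h₂.2 j (h.size_le.trans_lt hj)⟩,
        ⟨h₁, h₄, h₅.trans_le h.size_le, ?_, by simpa [nextCell, hp] using hpl⟩, h₃.left_eq⟩
      rw [← h.text, h₃.right_eq]
      simp [h₃.left_eq]
  have hlen := congrArg List.length hX
  rw [List.length_append] at hlen
  refine ⟨X, Y, ?_, hX', hY', hlen, fun p hp => ?_⟩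
  · rw [← h.text, hX, hY]; simp [TapeZipper.window]
  · simp only [TapeZipper.window, List.length_append] at hp
    rw [relocate]
    split_ifs with h₁ h₂
    · obtain ⟨h₃, h₄, h₅⟩ := hXp p h₁
      exact ⟨h₃, h₄, by simp only [h₅]⟩
    · refine ⟨legal_zero m, ?_, ?_⟩
      · rw [addReg_zero]
        exact ⟨h.fits, h.sized, h.size_le, h.text, by dsimp only; omega⟩
      · simp only [addReg_zero, hlen]; omega
    · obtain ⟨h₃, h₄, h₅⟩ := hYp (p - (Z.prevCell z).length - Z.cell.length) (by omega)
      exact ⟨h₃, h₄, by simp only [h₅, List.length_append, hlen]; omega⟩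

end TapeZipper

/-! ### The accelerated machine: definition, finiteness, determinism -/

namespace CounterMachine

open TapeZipper TapeParser

variable {α : Type*} {k : ℕ}

/-- The states of the accelerated machine: `table p` has read the short prefix `p` and does
nothing else, `parse F` compresses the input, `sim Z off q ρ` simulates `M` in state `q` with the
head on letter `off` of the current cell of `Z` and with remainders `ρ` of the counters. -/
inductive FastState (M : CounterMachine α k) where
  | table (p : List α)
  | accept
  | reject
  | parse (F : List (List (TapeSymbol α) × List (TapeSymbol α)) × List (TapeSymbol α))
  | sim (Z : TapeZipper (TapeSymbol α)) (off : ℕ) (q : M.State) (ρ : Fin k → ℕ)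

section Fast

variable (M : CounterMachine α k) (m K Q E B : ℕ)

/-- Zero tests for the registers: register `0` is the distance of the head from the right
end-marker, the others are counters. -/
def regTest (a : TapeSymbol α) (z : Fin (k + m) → Bool) : ℕ → Bool
  | 0 => match a with
    | TapeSymbol.right => true
    | _ => false
  | j + 1 => if h : j < m then z (Fin.natAdd k ⟨j, h⟩) else true

/-- The contents of the registers. -/
def regs (w : List α) (pos : ℕ) (cnt : Fin (k + m) → ℕ) : ℕ → ℕ
  | 0 => w.length + 1 - pos
  | j + 1 => if h : j < m then cnt (Fin.natAdd k ⟨j, h⟩) else 0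

/-- The configuration of `M` on the window of a zipper that a simulation starts from. -/
def windowConfig (zr : ℕ → Bool) (z : Fin k → Bool) (Z : TapeZipper (TapeSymbol α)) (off : ℕ)
    (q : M.State) (ρ : Fin k → ℕ) : M.Config where
  state := q
  pos := (Z.prevCell zr).length + off
  counter := fun i => (if z i then 0 else K) + ρ i

/-- The move of the accelerated machine that leads to the configuration `d` of the window. -/
noncomputable def simMove (zr : ℕ → Bool) (z : Fin k → Bool) (Z : TapeZipper (TapeSymbol α)) (d : M.Config) :
    FastState M × SignType × (Fin (k + m) → SignType) :=
  (.sim (Z.relocate zr d.pos).1 (Z.relocate zr d.pos).2.2 d.state (fun i => d.counter i % K),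
    -(Z.relocate zr d.pos).2.1 0,
    Fin.addCases (fun i => SignType.sign (((d.counter i / K : ℕ) : ℤ) - if z i then 0 else 1))
      (fun j => (Z.relocate zr d.pos).2.1 (j + 1)))

/-- The moves of the accelerated machine. -/
noncomputable def fastTrans : FastState M → TapeSymbol α → (Fin (k + m) → Bool) →
    Set (FastState M × SignType × (Fin (k + m) → SignType))
  | .table p, .letter a, _ =>
    {μ | p.length ≤ E ∧ μ = (.table (p ++ [a]), 1, 0) ∨
      ¬ p.length ≤ E ∧
        (M.AcceptsWithin (.left :: p.map .letter) E M.init ∧ μ = (.accept, 1, 0) ∨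
        (∃ c, M.StepsOn (.left :: p.map .letter) E M.init c) ∧
          μ = (.parse ([], .left :: (p ++ [a]).map .letter), 1, 0) ∨
        ¬ M.AcceptsWithin (.left :: p.map .letter) E M.init ∧
          (¬ ∃ c, M.StepsOn (.left :: p.map .letter) E M.init c) ∧ μ = (.reject, 1, 0))}
  | .parse F, .letter a, _ =>
    {(.parse (absorb Q F (.letter a)).1, 1,
      Fin.addCases (fun _ => 0) (fun j => (absorb Q F (.letter a)).2 j))}
  | .parse F, .right, _ =>
    {(.sim (rewind F.1 (F.2 ++ [.right]) []) 1 M.start (fun _ => 0), 0, 0)}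
  | .sim Z off q ρ, a, z =>
    {μ | M.AcceptsWithin (Z.window (regTest m a z)) K
          (M.windowConfig K (regTest m a z) (fun i => z (Fin.castAdd m i)) Z off q ρ) ∧
          μ = (.accept, 0, 0) ∨
        ∃ d, M.StepsOn (Z.window (regTest m a z)) K
          (M.windowConfig K (regTest m a z) (fun i => z (Fin.castAdd m i)) Z off q ρ) d ∧
          μ = M.simMove m K (regTest m a z) (fun i => z (Fin.castAdd m i)) Z d}
  | _, _, _ => ∅

/-- The states that the accelerated machine may use. -/
def fastStates : Set (FastState M)
  | .table p => p.length ≤ E + 1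
  | .accept => True
  | .reject => True
  | .parse F => F.1.length ≤ m ∧ (∀ p ∈ F.1, p.1.length ≤ B ∧ p.2.length ≤ B) ∧ F.2.length ≤ B
  | .sim Z off _ ρ => Z.Sized Q B ∧ Z.size ≤ m ∧ off ≤ B ∧ ∀ i, ρ i < K

/-- The final states of the accelerated machine. -/
def fastFinal : Set (FastState M)
  | .table p => p ∈ M.language
  | .accept => True
  | _ => False

theorem finite_lists {γ : Type*} {s : Set γ} (hs : s.Finite) (n : ℕ) :
    {l : List γ | l.length ≤ n ∧ ∀ x ∈ l, x ∈ s}.Finite := by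
  have := hs.to_subtype
  refine ((List.finite_length_le s n).image (List.map Subtype.val)).subset ?_
  rintro l ⟨h₁, h₂⟩
  exact ⟨l.attach.map fun x => ⟨x.1, h₂ x.1 x.2⟩, by simpa using h₁, by simp⟩

theorem finite_fastStates [Finite α] : (M.fastStates m K Q E B).Finite := by
  have := M.finite_state
  have hw : {l : List (TapeSymbol α) | l.length ≤ B}.Finite := List.finite_length_le _ B
  have hp := hw.prod hw
  have hl := finite_lists hp m
  have hρ : {ρ : Fin k → ℕ | ∀ i, ρ i < K}.Finite := by
    simpa [Set.pi] using Set.Finite.pi' (fun _ : Fin k => Set.finite_lt_nat K)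
  have h₁ := (List.finite_length_le α (E + 1)).image (FastState.table (M := M))
  have h₂ := (hl.prod hw).image (FastState.parse (M := M))
  have hz := ((hl.prod hw).prod (hl.prod (Set.finite_univ (α := Bool)))).image
    fun x => TapeZipper.mk x.1.1 x.1.2 x.2.1 x.2.2
  have h₃ := ((hz.prod (Set.finite_le_nat B)).prod
    ((Set.finite_univ (α := M.State)).prod hρ)).image
    fun x => FastState.sim (M := M) x.1.1 x.1.2 x.2.1 x.2.2
  refine (((h₁.union h₂).union h₃).union (Set.toFinite {FastState.accept, FastState.reject})).subset
    ?_
  rintro (p | _ | _ | ⟨l, x⟩ | ⟨⟨l, x, r, b⟩, off, q, ρ⟩) h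
  · exact .inl (.inl (.inl ⟨p, h, rfl⟩))
  · exact .inr (by simp)
  · exact .inr (by simp)
  · exact .inl (.inl (.inr ⟨(l, x), ⟨⟨h.1, h.2.1⟩, h.2.2⟩, rfl⟩))
  · obtain ⟨⟨h₁, h₂, h₃⟩, h₄, h₅, h₆⟩ := h
    simp only [size] at h₄
    refine .inl (.inr ⟨((⟨l, x, r, b⟩, off), (q, ρ)), ⟨⟨?_, h₅⟩, trivial, h₆⟩, rfl⟩)
    refine ⟨((l, x), (r, b)), ⟨⟨⟨by dsimp only at h₄ ⊢; omega, fun p hp => ?_⟩, h₃.2⟩,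
      ⟨by dsimp only at h₄ ⊢; omega, fun p hp => ?_⟩, trivial⟩, rfl⟩
    · exact ⟨(h₁ p hp).1.2, (h₁ p hp).2.2⟩
    · exact ⟨(h₂ p hp).1.2, (h₂ p hp).2.2⟩

instance [Finite α] : Finite (M.fastStates m K Q E B) := M.finite_fastStates m K Q E B

/-- The meaning of a state of the accelerated machine. -/
noncomputable def decode [Finite α] (q : Shrink.{0} (M.fastStates m K Q E B)) : FastState M :=
  ((equivShrink.{0} (M.fastStates m K Q E B)).symm q).1

/-- The accelerated machine. -/
noncomputable def fast [Finite α] : CounterMachine α (k + m) where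
  State := Shrink.{0} (M.fastStates m K Q E B)
  finite_state := Finite.of_equiv _ (equivShrink.{0} (M.fastStates m K Q E B))
  start := equivShrink.{0} (M.fastStates m K Q E B) ⟨.table [], Nat.zero_le _⟩
  final := {q | M.decode m K Q E B q ∈ M.fastFinal}
  trans q a z := {μ | (M.decode m K Q E B μ.1, μ.2) ∈
    M.fastTrans m K Q E (M.decode m K Q E B q) a z}

variable {M m K Q E B}

theorem decode_mem [Finite α] (q : (M.fast m K Q E B).State) :
    M.decode m K Q E B q ∈ M.fastStates m K Q E B :=
  ((equivShrink.{0} (M.fastStates m K Q E B)).symm q).2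

theorem decode_injective [Finite α] : Function.Injective (M.decode m K Q E B) :=
  Subtype.val_injective.comp (equivShrink.{0} (M.fastStates m K Q E B)).symm.injective

theorem exists_decode [Finite α] {x : FastState M} (hx : x ∈ M.fastStates m K Q E B) :
    ∃ q : (M.fast m K Q E B).State, M.decode m K Q E B q = x :=
  ⟨equivShrink.{0} (M.fastStates m K Q E B) ⟨x, hx⟩, by simp [decode]⟩

theorem decode_start [Finite α] : M.decode m K Q E B (M.fast m K Q E B).start = .table [] := by
  simp [decode, fast]

theorem mem_fastTrans_sim {Z : TapeZipper (TapeSymbol α)} {off : ℕ} {q : M.State} {ρ : Fin k → ℕ}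
    {a : TapeSymbol α} {z : Fin (k + m) → Bool}
    {μ : FastState M × SignType × (Fin (k + m) → SignType)} :
    μ ∈ M.fastTrans m K Q E (.sim Z off q ρ) a z ↔
      M.AcceptsWithin (Z.window (regTest m a z)) K
          (M.windowConfig K (regTest m a z) (fun i => z (Fin.castAdd m i)) Z off q ρ) ∧
          μ = (.accept, 0, 0) ∨
        ∃ d, M.StepsOn (Z.window (regTest m a z)) K
          (M.windowConfig K (regTest m a z) (fun i => z (Fin.castAdd m i)) Z off q ρ) d ∧
          μ = M.simMove m K (regTest m a z) (fun i => z (Fin.castAdd m i)) Z d := by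
  cases a <;> rfl

theorem mem_moves_fast [Finite α] {w : List α} {c : (M.fast m K Q E B).Config}
    {μ : (M.fast m K Q E B).State × SignType × (Fin (k + m) → SignType)} :
    μ ∈ (M.fast m K Q E B).moves w c ↔ (M.decode m K Q E B μ.1, μ.2) ∈ M.fastTrans m K Q E (M.decode m K Q E B c.state)
      (scan w c.pos) (fun i => decide (c.counter i = 0)) := Iff.rfl

theorem mem_final_fast [Finite α] {q : (M.fast m K Q E B).State} :
    q ∈ (M.fast m K Q E B).final ↔ M.decode m K Q E B q ∈ M.fastFinal := Iff.rfl

theorem exists_reaches_succ [Finite α] {w : List α} {s : ℕ} {c : (M.fast m K Q E B).Config}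
    (hc : (M.fast m K Q E B).Reaches w s c) {x : FastState M} {d : SignType}
    {e : Fin (k + m) → SignType} (hx : x ∈ M.fastStates m K Q E B)
    (h : (x, d, e) ∈ M.fastTrans m K Q E (M.decode m K Q E B c.state) (scan w c.pos)
      (fun i => decide (c.counter i = 0))) :
    ∃ c', (M.fast m K Q E B).Reaches w (s + 1) c' ∧ M.decode m K Q E B c'.state = x ∧
      c'.pos = min (w.length + 1) ((c.pos : ℤ) + (d : ℤ)).toNat ∧
      c'.counter = fun i => ((c.counter i : ℤ) + (e i : ℤ)).toNat := by
  obtain ⟨q, rfl⟩ := exists_decode hx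
  exact ⟨_, hc.succ (μ := (q, d, e)) h, rfl, rfl, rfl⟩

/-- Parsing is a function, and a deterministic `M` cannot both halt early and keep running.
Restricting to the finite set of states only removes moves. -/
theorem Deterministic.fast [Finite α] (hM : M.Deterministic) :
    (M.fast m K Q E B).Deterministic := by
  intro q a z μ hμ ν hν
  have hμ' : (M.decode m K Q E B μ.1, μ.2) ∈ M.fastTrans m K Q E (M.decode m K Q E B q) a z := hμ
  have hν' : (M.decode m K Q E B ν.1, ν.2) ∈ M.fastTrans m K Q E (M.decode m K Q E B q) a z := hν
  suffices h : (M.decode m K Q E B μ.1, μ.2) = (M.decode m K Q E B ν.1, ν.2) by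
    rw [Prod.mk.injEq] at h
    exact Prod.ext (decode_injective h.1) h.2
  generalize (M.decode m K Q E B μ.1, μ.2) = μ at *
  generalize (M.decode m K Q E B ν.1, ν.2) = ν at *
  have key : ∀ (T : List (TapeSymbol α)) n c, M.AcceptsWithin T n c → ¬ ∃ d, M.StepsOn T n c d := by
    rintro T n c ⟨j, hj, d, h₁, h₂, -⟩ ⟨d', h⟩
    exact hM.not_stepsOn_of_halted hj h₁ h₂ h
  generalize M.decode m K Q E B q = x at *
  rcases x with p | _ | _ | F | ⟨Z, off, q, ρ⟩
  · rcases a with _ | a | _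
    · exact hμ'.elim
    · rcases hμ' with ⟨h₁, rfl⟩ | ⟨h₁, ⟨h₂, rfl⟩ | ⟨h₂, rfl⟩ | ⟨h₂, h₃, rfl⟩⟩ <;>
      rcases hν' with ⟨h₁', rfl⟩ | ⟨h₁', ⟨h₂', rfl⟩ | ⟨h₂', rfl⟩ | ⟨h₂', h₃', rfl⟩⟩ <;>
      first
      | rfl
      | exact absurd h₁ h₁'
      | exact absurd h₁' h₁
      | exact absurd h₂ h₂'
      | exact absurd h₂' h₂
      | exact absurd h₂' (key _ _ _ h₂)
      | exact absurd h₂ (key _ _ _ h₂')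
      | exact absurd h₂' h₃
      | exact absurd h₂ h₃'
    · exact hμ'.elim
  · cases a <;> exact hμ'.elim
  · cases a <;> exact hμ'.elim
  · rcases a with _ | a | _
    · exact hμ'.elim
    · exact hμ'.trans hν'.symm
    · exact hμ'.trans hν'.symm
  · rw [mem_fastTrans_sim] at hμ' hν'
    rcases hμ' with ⟨h₁, rfl⟩ | ⟨d, h₁, rfl⟩ <;> rcases hν' with ⟨h₂, rfl⟩ | ⟨d', h₂, rfl⟩
    · rfl
    · exact absurd ⟨_, h₂⟩ (key _ _ _ h₁)
    · exact absurd ⟨_, h₁⟩ (key _ _ _ h₂)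
    · rw [hM.stepsOn_unique h₁ h₂]

end Fast

end CounterMachine

/-! ### One accelerated step against `K` steps of `M` -/

namespace CounterMachine

open TapeZipper TapeParser

variable {α : Type*} {k : ℕ} {M : CounterMachine α k} {m K Q E B : ℕ}

theorem regTest_iff {w : List α} {pos : ℕ} (hpos : pos ≤ w.length + 1) (cnt : Fin (k + m) → ℕ)
    (j : ℕ) :
    regTest m (scan w pos) (fun i => decide (cnt i = 0)) j = true ↔ regs m w pos cnt j = 0 := by
  rcases j with _ | j
  · have h : regTest m (scan w pos) (fun i => decide (cnt i = 0)) 0 = true ↔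
        scan w pos = TapeSymbol.right := by
      cases scan w pos <;> simp [regTest]
    rw [h, scan_eq_right_iff w hpos, regs]
    omega
  · by_cases h : j < m <;> simp [regTest, regs, h]

/-- The head moves by `-δ 0` because register `0` is a distance from the right. Legality and `h₀`
exclude the clamping at the right and left end of the tape, respectively. -/
theorem regs_move {w : List α} {pos : ℕ} (hpos : pos ≤ w.length + 1) (cnt : Fin (k + m) → ℕ)
    {δ : ℕ → SignType} (hδ : Legal (regs m w pos cnt) δ m)
    (h₀ : addReg (regs m w pos cnt) δ 0 ≤ w.length + 1) (e : Fin k → SignType) :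
    regs m w (min (w.length + 1) ((pos : ℤ) + ((-δ 0 : SignType) : ℤ)).toNat)
      (fun i => ((cnt i : ℤ) + ((Fin.addCases e (fun j => δ (j + 1)) i : SignType) : ℤ)).toNat) =
    addReg (regs m w pos cnt) δ := by
  funext j
  rcases j with _ | j
  · have h₁ := hδ.1 0
    simp only [regs, addReg] at h₀ h₁ ⊢
    cases hd : δ 0
    · simp; omega
    · have := h₁ (by rw [hd]; rfl)
      simp; omega
    · simp [hd] at h₀ ⊢; omega
  · by_cases h : j < m
    · simp only [regs, addReg, dif_pos h, Fin.addCases_right]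
    · simp [regs, addReg, h, hδ.2 (j + 1) (by omega)]

/-- The configuration `c` of `M` is represented by a configuration of the accelerated machine. -/
def Simulates (m K Q B : ℕ) (w : List α) (x : FastState M) (pos : ℕ) (cnt : Fin (k + m) → ℕ)
    (c : M.Config) : Prop :=
  ∃ Z off ρ, x = .sim Z off c.state ρ ∧ pos ≤ w.length + 1 ∧
    Represents Q B m (tape w) (regs m w pos cnt) Z off ∧
    c.pos = (Z.left (regs m w pos cnt)).length + off ∧
    (∀ i, c.counter i = K * cnt (Fin.castAdd m i) + ρ i) ∧ ∀ i, ρ i < K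

theorem Simulates.mem_fastStates {w : List α} {x : FastState M} {pos : ℕ}
    {cnt : Fin (k + m) → ℕ} {c : M.Config} (h : Simulates m K Q B w x pos cnt c) :
    x ∈ M.fastStates m K Q E B := by
  obtain ⟨Z, off, ρ, rfl, -, h, -, -, hρ⟩ := h
  exact ⟨h.sized, h.size_le, h.off_lt.le.trans h.sized.length_cell.2, hρ⟩

/-- Carrying over in the compressed representation of a counter. -/
theorem compress_carry {n ρ d : ℕ} (hρ : ρ < K)
    (hd : d ≤ (if n = 0 then 0 else K) + ρ + K) :
    K * (n - 1) + d = K * ((n : ℤ) +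
      ((SignType.sign (((d / K : ℕ) : ℤ) - if n = 0 then 0 else 1) : SignType) : ℤ)).toNat +
      d % K := by
  have hK : 0 < K := by omega
  have hdiv := Nat.div_add_mod d K
  rcases n with _ | n
  · have hq : d / K < 2 := by
      rw [Nat.div_lt_iff_lt_mul hK]; simp at hd; omega
    generalize d / K = q at *
    interval_cases q <;> simp at hdiv ⊢ <;> omega
  · have hq : d / K < 3 := by
      rw [Nat.div_lt_iff_lt_mul hK]; simp at hd; omega
    generalize d / K = q at *
    interval_cases q
    · simp at hdiv ⊢; omega
    · simp at hdiv ⊢; rw [Nat.mul_succ]; omega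
    · have : ((n : ℤ) + 1 + 1).toNat = n + 2 := by omega
      simp at hdiv ⊢; rw [this, Nat.mul_add]; omega

theorem Simulates.window (hKQ : K ≤ Q) (hQ : 1 ≤ Q) {w : List α}
    {Z : TapeZipper (TapeSymbol α)} {off : ℕ} {q : M.State} {ρ : Fin k → ℕ} {pos : ℕ}
    {cnt : Fin (k + m) → ℕ} {c : M.Config}
    (h : Simulates m K Q B w (.sim Z off q ρ) pos cnt c) {zr : ℕ → Bool} {z : Fin k → Bool}
    (hzr : ∀ j, zr j = true ↔ regs m w pos cnt j = 0)
    (hz : ∀ i, z i = decide (cnt (Fin.castAdd m i) = 0)) :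
    ∃ X Y e, X ++ Z.window zr ++ Y = tape w ∧
      c = shift X.length e (M.windowConfig K zr z Z off q ρ) ∧
      Margin K X (Z.window zr) Y e (M.windowConfig K zr z Z off q ρ) ∧
      ∀ d, M.StepsOn (Z.window zr) K (M.windowConfig K zr z Z off q ρ) d →
        Simulates m K Q B w (M.simMove m K zr z Z d).1
          (min (w.length + 1) ((pos : ℤ) + ((M.simMove m K zr z Z d).2.1 : ℤ)).toNat)
          (fun i => ((cnt i : ℤ) + ((M.simMove m K zr z Z d).2.2 i : ℤ)).toNat)
          (shift X.length e d) := by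
  obtain ⟨Z', off', ρ', hx, hpos, hrep, hcpos, hccnt, hρ⟩ := h
  cases hx
  obtain ⟨X, Y, hT, hX, hY, hlen, hrel⟩ := hrep.window hzr
  have hoff := hrep.off_lt
  -- All but one of the `K`-blocks of a counter are set aside; truncated subtraction sets aside
  -- nothing when `cnt` is zero. What remains is `K + ρ i` or the full value `ρ i`.
  have hmar : Margin K X (Z.window zr) Y (fun i => K * (cnt (Fin.castAdd m i) - 1))
      (M.windowConfig K zr z Z off c.state ρ) := by
    refine ⟨?_, ?_, fun i => ?_⟩
    · exact hX.imp_right fun h => by simp only [windowConfig]; omega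
    · simp only [windowConfig, TapeZipper.window, List.length_append]
      rcases hY with h | h
      · exact .inr ⟨h, by omega⟩
      · exact .inl (by omega)
    · simp only [windowConfig, hz]
      by_cases h : cnt (Fin.castAdd m i) = 0
      · left; simp [h]
      · right; simp [h]
  refine ⟨X, Y, _, hT, ?_, hmar, fun d hd => ?_⟩
  · ext i
    · rfl
    · simp only [shift, windowConfig]; omega
    · simp only [shift, windowConfig, hccnt, hz]
      by_cases h : cnt (Fin.castAdd m i) = 0
      · simp [h]
      · obtain ⟨n, hn⟩ := Nat.exists_eq_succ_of_ne_zero h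
        simp [hn, Nat.mul_succ, Nat.add_assoc]
  · obtain ⟨hleg, hrep', hpos'⟩ := hrel d.pos
      (Margin.steps (n := K) (b := 0) (by simpa using hmar) hT hd).pos_lt
    have h₀ := reg_zero_lt hQ hrep'.sized hrep'.fits
    rw [hrep'.text, length_tape] at h₀
    have hregs : regs m w
        (min (w.length + 1) ((pos : ℤ) + ((M.simMove m K zr z Z d).2.1 : ℤ)).toNat)
        (fun i => ((cnt i : ℤ) + ((M.simMove m K zr z Z d).2.2 i : ℤ)).toNat) =
        addReg (regs m w pos cnt) (Z.relocate zr d.pos).2.1 := regs_move hpos cnt hleg (by omega)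
      (fun i => SignType.sign (((d.counter i / K : ℕ) : ℤ) - if z i then 0 else 1))
    refine ⟨_, _, _, rfl, min_le_left _ _, ?_, ?_, fun i => ?_, fun i => Nat.mod_lt _ ?_⟩
    · rw [hregs]; exact hrep'
    · rw [hregs]; exact hpos'.symm
    · have hle := hd.counter_le i
      have := compress_carry (K := K) (n := cnt (Fin.castAdd m i)) (hρ i) (d := d.counter i)
        (by simpa [windowConfig, hz] using hle)
      simpa [shift, simMove, hz] using this
    · have := hρ i; omega

end CounterMachine

/-! ### Invariant, completeness and soundness of the accelerated machine -/

namespace CounterMachine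

open TapeZipper TapeParser

variable {α : Type*} {k : ℕ} {M : CounterMachine α k} {m K Q E B : ℕ} {w : List α}

/-- What holds when the accelerated machine reaches a configuration after `s` steps. -/
def FastInv (M : CounterMachine α k) (m K Q E B : ℕ) (w : List α) (s pos : ℕ)
    (cnt : Fin (k + m) → ℕ) : FastState M → Prop
  | .table p => p = w.take s ∧ s ≤ w.length ∧ pos = s + 1 ∧ cnt = 0
  | .accept => w ∈ M.language ∧ (s ≤ w.length ∨
      (∃ c, M.StepsOn (tape w) E M.init c) ∧
        ∃ j c, s = w.length + 2 + j ∧ M.StepsOn (tape w) (K * j) M.init c)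
  | .reject => s ≤ w.length
  | .parse F => s ≤ w.length ∧ pos = s + 1 ∧
      Describes Q (.left :: (w.take s).map .letter) F (fun j => regs m w pos cnt (j + 1)) ∧
      (∀ i, cnt (Fin.castAdd m i) = 0) ∧ ∃ c, M.StepsOn (tape w) E M.init c
  | .sim Z off q ρ => (∃ c, M.StepsOn (tape w) E M.init c) ∧
      ∃ j c, s = w.length + 1 + j ∧ M.StepsOn (tape w) (K * j) M.init c ∧
        Simulates m K Q B w (.sim Z off q ρ) pos cnt c

theorem AcceptsWithin.mem_language {n j : ℕ} {c : M.Config}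
    (hc : M.StepsOn (tape w) j M.init c) (h : M.AcceptsWithin (tape w) n c) :
    w ∈ M.language := by
  obtain ⟨i, -, d, h₁, h₂, h₃⟩ := h
  exact ⟨j + i, acceptsIn_iff.2 ⟨d, stepsOn_add.2 ⟨c, hc, h₁⟩, h₂, h₃⟩⟩

/-- Short computations depend on a prefix of the input only. -/
theorem prefix_window (hE : E < w.length) :
    (M.AcceptsWithin (.left :: (w.take (E + 1)).map .letter) E M.init ↔
      M.AcceptsWithin (tape w) E M.init) ∧
    ((∃ c, M.StepsOn (.left :: (w.take (E + 1)).map .letter) E M.init c) ↔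
      ∃ c, M.StepsOn (tape w) E M.init c) := by
  have hT : [] ++ (TapeSymbol.left :: (w.take (E + 1)).map TapeSymbol.letter) ++
      ((w.drop (E + 1)).map TapeSymbol.letter ++ [TapeSymbol.right]) = tape w := by
    simp only [tape, List.nil_append, List.cons_append, ← List.append_assoc, ← List.map_append,
      List.take_append_drop]
  have hm : Margin E [] (TapeSymbol.left :: (w.take (E + 1)).map TapeSymbol.letter)
      ((w.drop (E + 1)).map TapeSymbol.letter ++ [TapeSymbol.right]) (fun _ => 0) M.init := by
    refine ⟨.inl rfl, .inl ?_, fun _ => .inl rfl⟩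
    simp [init]
    omega
  have hi : shift 0 (fun _ => 0) M.init = M.init := by
    ext <;> simp [shift]
  have h₁ := hm.acceptsWithin_iff hT
  have h₂ := fun c' => Margin.stepsOn_iff (n := E) (b := 0) (by simpa using hm) hT (c' := c')
  simp only [List.length_nil, hi] at h₁ h₂
  refine ⟨h₁.symm, ?_, ?_⟩
  · rintro ⟨c, hc⟩; exact ⟨_, (h₂ _).2 ⟨c, hc, rfl⟩⟩
  · rintro ⟨c, hc⟩
    obtain ⟨d, hd, -⟩ := (h₂ _).1 hc
    exact ⟨d, hd⟩

theorem scan_letter {s : ℕ} (hs : s < w.length) : scan w (s + 1) = .letter w[s] := by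
  simp [scan, hs]

theorem lt_of_scan_letter {s : ℕ} {a : α} (h : scan w (s + 1) = .letter a) :
    ∃ hs : s < w.length, w[s] = a := by
  by_cases hs : s < w.length
  · exact ⟨hs, by simpa [scan_letter hs] using h⟩
  · simp [scan, List.getElem?_eq_none (not_lt.1 hs)] at h

/-- Exponents from `m` on have no counter, so the parser must never change them. -/
theorem absorb_support {γ : Type*} (F : List (List γ × List γ) × List γ) (a : γ)
    (hF : ∀ p ∈ F.1, p.2.length = Q) (hm : F.1.length ≤ m) {j : ℕ} (hj : m ≤ j) :
    (absorb Q F a).2 j = 0 := by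
  rcases absorb_cases F a hF with ⟨u, D, l, hl, -, he⟩ | ⟨-, v, E, -, -, he⟩ | ⟨-, -, he⟩
  · rw [hl, List.length_cons] at hm
    have : j ≠ l.length := by omega
    simp [he, this]
  · simp [he]
  · simp [he]

theorem regs_parse {δ : ℕ → SignType} (hδ : ∀ j, m ≤ j → δ j = 0) (pos pos' : ℕ)
    (cnt : Fin (k + m) → ℕ) :
    (fun j => regs m w pos' (fun i => ((cnt i : ℤ) +
      ((Fin.addCases (fun _ => 0) (fun j => δ j) i : SignType) : ℤ)).toNat) (j + 1)) =
    addReg (fun j => regs m w pos cnt (j + 1)) δ := by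
  funext j
  by_cases h : j < m
  · simp only [regs, addReg, dif_pos h, Fin.addCases_right]
  · simp [regs, addReg, h, hδ j (by omega)]

theorem simulates_init (hK : 1 ≤ K) (hQ : 2 ≤ Q) {cnt : Fin (k + m) → ℕ}
    {F : List (List (TapeSymbol α) × List (TapeSymbol α)) × List (TapeSymbol α)}
    (hF : Describes Q (.left :: w.map .letter) F
      (fun j => regs m w (w.length + 1) cnt (j + 1)))
    (hcnt : ∀ i, cnt (Fin.castAdd m i) = 0)
    (hs : (rewind F.1 (F.2 ++ [.right]) []).Sized Q B)
    (hs' : (rewind F.1 (F.2 ++ [.right]) []).size ≤ m) :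
    Simulates m K Q B w
      (.sim (rewind F.1 (F.2 ++ [.right]) []) 1 M.start (fun _ => 0)) (w.length + 1) cnt
      M.init := by
  obtain ⟨hb, hr⟩ := rewind_left F.1 (F.2 ++ [.right]) []
  have hl : (rewind F.1 (F.2 ++ [.right]) []).left (regs m w (w.length + 1) cnt) = [] := by
    simp [left, hb, textBefore]
  refine ⟨_, _, _, rfl, le_rfl, ⟨⟨fun _ => ?_, fun h => ?_⟩, hs, hs', ?_, ?_⟩, ?_, ?_, ?_⟩
  · simp [hb, regs]
  · simp [hr] at h
  · rw [hl, List.nil_append, rewind_text]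
    simp only [textAfter, List.append_nil, ← List.append_assoc, ← hF.text]
    simp [tape]
  -- The head of `M` starts at position `1` of the first word, which has at least `Q ≥ 2` letters.
  · have := hs.length_cell.1; omega
  · simp [hl, init]
  · intro i; simp [init, hcnt]
  · intro i; omega

theorem FastInv.step (hK : 1 ≤ K) (hKQ : K ≤ Q) (hQ : 2 ≤ Q) (hE : Q ≤ E + 3) {s pos : ℕ}
    {cnt : Fin (k + m) → ℕ} {x x' : FastState M} {d : SignType} {e : Fin (k + m) → SignType}
    (h : FastInv M m K Q E B w s pos cnt x) (hx : x ∈ M.fastStates m K Q E B)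
    (hx' : x' ∈ M.fastStates m K Q E B)
    (hμ : (x', d, e) ∈ M.fastTrans m K Q E x (scan w pos) (fun i => decide (cnt i = 0))) :
    FastInv M m K Q E B w (s + 1) (min (w.length + 1) ((pos : ℤ) + (d : ℤ)).toNat)
      (fun i => ((cnt i : ℤ) + (e i : ℤ)).toNat) x' := by
  rcases x with p | _ | _ | F | ⟨Z, off, q, ρ⟩
  · obtain ⟨rfl, hs, rfl, rfl⟩ := h
    rcases hsc : scan w (s + 1) with _ | a | _ <;> rw [hsc] at hμ
    · exact hμ.elim
    · obtain ⟨hs', ha⟩ := lt_of_scan_letter hsc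
      have htake : w.take (s + 1) = w.take s ++ [a] := by rw [← ha, List.take_append_getElem hs']
      rcases hμ with ⟨h₁, h⟩ | ⟨h₁, ⟨h₂, h⟩ | ⟨h₂, h⟩ | ⟨h₂, h₃, h⟩⟩
      · cases h
        refine ⟨htake.symm, hs', ?_, ?_⟩
        · simp; omega
        · funext i; simp
      all_goals
        obtain rfl : s = E + 1 := by
          have : (w.take s).length ≤ E + 1 := hx
          simp at this h₁; omega
      · cases h
        exact ⟨AcceptsWithin.mem_language (j := 0) rfl ((prefix_window (by omega)).1.1 h₂),
          .inl hs'⟩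
      · cases h
        refine ⟨hs', by simp; omega, ?_, fun i => by simp, (prefix_window (by omega)).2.1 h₂⟩
        rw [htake]
        refine ⟨by simp [textBefore], fun j _ => ?_, by simp, by simp; omega⟩
        simp [regs]
      · cases h; exact hs'
    · exact hμ.elim
  · rcases hsc : scan w pos with _ | a | _ <;> rw [hsc] at hμ <;> exact hμ.elim
  · rcases hsc : scan w pos with _ | a | _ <;> rw [hsc] at hμ <;> exact hμ.elim
  · obtain ⟨hs, rfl, hd, hcnt, hlong⟩ := h
    rcases hsc : scan w (s + 1) with _ | a | _ <;> rw [hsc] at hμ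
    · exact hμ.elim
    · obtain ⟨hs', ha⟩ := lt_of_scan_letter hsc
      have htake : w.take (s + 1) = w.take s ++ [a] := by rw [← ha, List.take_append_getElem hs']
      cases hμ
      refine ⟨hs', by simp; omega, ?_, fun i => by simp [hcnt], hlong⟩
      rw [regs_parse (fun j hj => absorb_support F _ (fun p hp => (hd.length_pair p hp).2) hx.1 hj)
        (s + 1)]
      have := hd.absorb (.letter a)
      rw [htake]
      simpa using this
    · obtain rfl : s = w.length := by
        have := (scan_eq_right_iff w (by omega)).1 hsc
        omega
      cases hμ
      rw [List.take_length] at hd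
      refine ⟨hlong, 0, M.init, rfl, by simp [StepsOn], ?_⟩
      have := simulates_init (M := M) hK hQ hd hcnt hx'.1 hx'.2.1
      simpa using this
  · obtain ⟨hlong, j, c, rfl, hc, hsim⟩ := h
    have hpos : pos ≤ w.length + 1 := by obtain ⟨_, _, _, -, h, -⟩ := hsim; exact h
    rw [mem_fastTrans_sim] at hμ
    obtain ⟨X, Y, e', hT, rfl, hmar, hstep⟩ := hsim.window hKQ (by omega)
      (z := fun i => decide (cnt (Fin.castAdd m i) = 0)) (regTest_iff hpos cnt) (fun i => rfl)
    rcases hμ with ⟨h, he⟩ | ⟨d', h, he⟩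
    · cases he
      exact ⟨AcceptsWithin.mem_language hc ((hmar.acceptsWithin_iff hT).2 h),
        .inr ⟨hlong, j, _, by omega, hc⟩⟩
    · have hs := hstep d' h
      have hst := (Margin.stepsOn_iff (n := K) (b := 0) (by simpa using hmar) hT).2 ⟨d', h, rfl⟩
      obtain ⟨rfl, h'⟩ := Prod.mk.inj he
      obtain ⟨rfl, rfl⟩ := Prod.mk.inj h'
      refine ⟨hlong, j + 1, _, rfl, ?_, hs⟩
      rw [Nat.mul_succ]
      exact stepsOn_add.2 ⟨_, hc, hst⟩

theorem fastInv_of_reaches [Finite α] (hK : 1 ≤ K) (hKQ : K ≤ Q) (hQ : 2 ≤ Q) (hE : Q ≤ E + 3)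
    {s : ℕ} {c : (M.fast m K Q E B).Config} (h : (M.fast m K Q E B).Reaches w s c) :
    FastInv M m K Q E B w s c.pos c.counter (M.decode m K Q E B c.state) := by
  induction h with
  | zero =>
    rw [show (M.fast m K Q E B).init.state = (M.fast m K Q E B).start from rfl, decode_start]
    exact ⟨by simp, Nat.zero_le _, rfl, rfl⟩
  | succ _ hμ ih => exact ih.step hK hKQ hQ hE (decode_mem _) (decode_mem _) hμ

/-! ### The accelerated machine accepts -/

section Complete

variable [Finite α]

theorem exists_reaches_table (hK : 1 ≤ K) (hKQ : K ≤ Q) (hQ : 2 ≤ Q) (hE : Q ≤ E + 3) {s : ℕ}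
    (hs : s ≤ w.length) (hsE : s ≤ E + 1) :
    ∃ c, (M.fast m K Q E B).Reaches w s c ∧ M.decode m K Q E B c.state = .table (w.take s) := by
  induction s with
  | zero => exact ⟨_, .zero, by rw [List.take_zero]; exact decode_start⟩
  | succ s ih =>
    obtain ⟨c, hc, hx⟩ := ih (by omega) (by omega)
    have hinv := fastInv_of_reaches hK hKQ hQ hE hc
    rw [hx] at hinv
    obtain ⟨-, -, hpos, -⟩ := hinv
    obtain ⟨c', hc', hx', -, -⟩ := exists_reaches_succ hc (x := .table (w.take s ++ [w[s]]))
      (d := 1) (e := 0) (by change List.length _ ≤ _; simp; omega) (by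
        rw [hx, hpos, scan_letter (by omega)]
        exact .inl ⟨by simp; omega, rfl⟩)
    exact ⟨c', hc', by rw [hx', List.take_append_getElem]⟩

/-- The bounds of `Bounded` keep the parser inside `fastStates`, so its moves are really available.
The parameter `H` is `E + 3`, since the end-marker and the first `E + 2` letters enter the rest
without a search for cubes. -/
theorem exists_reaches_parse (hK : 1 ≤ K) (hKQ : K ≤ Q) (hQ : 2 ≤ Q) (hE : Q ≤ E + 3)
    {S : Finset ℕ} (hS : S.card ≤ m) (hB : E + 3 + 3 * Q * (m + 1) ≤ B)
    (hw : NearlyPeriodic Q S (TapeSymbol.left :: w.map TapeSymbol.letter))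
    (hlong : ∃ c, M.StepsOn (tape w) E M.init c) {s : ℕ} (hs : s ≤ w.length) (hsE : E + 2 ≤ s) :
    ∃ c F, (M.fast m K Q E B).Reaches w s c ∧ M.decode m K Q E B c.state = .parse F ∧
      Bounded Q (E + 3) B S F (fun j => regs m w c.pos c.counter (j + 1)) := by
  have hB' : E + 3 + 3 * Q * (S.card + 1) ≤ B :=
    le_trans (Nat.add_le_add_left (Nat.mul_le_mul_left _ (by omega)) _) hB
  have hQB : Q ≤ B := by
    have := Nat.le_mul_of_pos_right (3 * Q) (Nat.succ_pos m)
    omega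
  induction s, hsE using Nat.le_induction with
  | base =>
    obtain ⟨c, hc, hx⟩ := exists_reaches_table (M := M) (m := m) (B := B) hK hKQ hQ hE
      (s := E + 1) (w := w) (by omega) le_rfl
    have hinv := fastInv_of_reaches hK hKQ hQ hE hc
    rw [hx] at hinv
    obtain ⟨-, -, hpos, hcnt⟩ := hinv
    obtain ⟨c', hc', hx', -, hcnt'⟩ := exists_reaches_succ hc
      (x := .parse ([], .left :: (w.take (E + 1) ++ [w[E + 1]]).map .letter))
      (d := 1) (e := 0) ⟨by simp, by simp, by simp; omega⟩ (by
        rw [hx, hpos, scan_letter (by omega)]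
        exact .inr ⟨by simp; omega, .inr (.inl ⟨(prefix_window (by omega)).2.2 hlong, rfl⟩)⟩)
    refine ⟨c', _, hc', hx', by simp, by simp, fun v E' x hE' h => ?_, by simp⟩
    have := congrArg List.length h
    simp at this
    omega
  | succ s hsE ih =>
    obtain ⟨c, F, hc, hx, hb⟩ := ih (by omega)
    have hinv := fastInv_of_reaches hK hKQ hQ hE hc
    have hmem := decode_mem c.state
    rw [hx] at hinv hmem
    obtain ⟨-, hpos, hd, hcnt, -⟩ := hinv
    have hd' := hd.absorb (.letter w[s])
    have htext : TapeSymbol.left :: w.map TapeSymbol.letter =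
        TapeSymbol.left :: (w.take s).map TapeSymbol.letter ++ [TapeSymbol.letter w[s]] ++
          (w.drop (s + 1)).map TapeSymbol.letter := by
      have h : w = w.take s ++ [w[s]] ++ w.drop (s + 1) := by
        rw [List.take_append_getElem, List.take_append_drop]
      have := congrArg (fun l => TapeSymbol.left :: l.map TapeSymbol.letter) h
      simpa only [List.map_append, List.map_cons, List.map_nil, List.cons_append] using this
    rw [htext] at hw
    have hb' := hb.absorb (by omega) (by omega) hB' hd hw.of_append
    have hlen := hb'.length_rest (by omega) (by omega) hd' hw.of_append
    obtain ⟨c', hc', hx', -, hcnt'⟩ := exists_reaches_succ hc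
      (x := .parse (absorb Q F (.letter w[s])).1) (d := 1)
      (e := Fin.addCases (fun _ => 0) (fun j => (absorb Q F (.letter w[s])).2 j))
      ⟨hb'.card.trans ((Finset.card_filter_le _ _).trans hS),
        fun p hp => ⟨hb'.length_word p hp, (hd'.length_pair p hp).2.trans_le hQB⟩,
        hlen.le.trans hB'⟩ (by
        rw [hx, hpos, scan_letter (by omega)]
        rfl)
    refine ⟨c', _, hc', hx', ?_⟩
    rw [hcnt', regs_parse (fun j hj => absorb_support F _ (fun p hp => (hd.length_pair p hp).2)
      hmem.1 hj) c.pos]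
    exact hb'

theorem exists_reaches_sim (hK : 1 ≤ K) (hKQ : K ≤ Q) (hQ : 2 ≤ Q) (hE : Q ≤ E + 3)
    {S : Finset ℕ} (hS : S.card ≤ m) (hB : E + 3 + 3 * Q * (m + 1) ≤ B)
    (hw : NearlyPeriodic Q S (TapeSymbol.left :: w.map TapeSymbol.letter))
    (hlong : ∃ c, M.StepsOn (tape w) E M.init c) (hsE : E + 2 ≤ w.length) {j : ℕ} {d : M.Config}
    (hd : M.StepsOn (tape w) (K * j) M.init d) :
    ∃ c, (M.fast m K Q E B).Reaches w (w.length + 1 + j) c ∧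
      Simulates m K Q B w (M.decode m K Q E B c.state) c.pos c.counter d := by
  induction j generalizing d with
  | zero =>
    cases hd
    obtain ⟨c, F, hc, hx, hb⟩ := exists_reaches_parse hK hKQ hQ hE hS hB hw hlong le_rfl hsE
    have hinv := fastInv_of_reaches hK hKQ hQ hE hc
    have hmem := decode_mem c.state
    rw [hx] at hinv hmem
    obtain ⟨-, hpos, hdes, hcnt, -⟩ := hinv
    rw [List.take_length] at hdes
    have hlen := hb.length_rest (by omega) (by omega) hdes hw
    have hB' : E + 3 + 3 * Q * (S.card + 1) ≤ B :=
      le_trans (Nat.add_le_add_left (Nat.mul_le_mul_left _ (by omega)) _) hB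
    have hrest := hdes.length_rest
    obtain ⟨hs, hs'⟩ := rewind_sized (Q := Q) (B := B) F.1 (F.2 ++ [.right]) [] ⟨fun p hp =>
        ⟨⟨(hdes.length_pair p hp).1, hb.length_word p hp⟩, (hdes.length_pair p hp).2.ge,
          (hmem.2.1 p hp).2⟩, by simp, by simp; omega, by simp; omega⟩
    rw [hpos] at hdes
    have hsim := simulates_init (M := M) hK hQ hdes hcnt hs (hs'.trans_le (by simpa using hmem.1))
    obtain ⟨c', hc', hx', hpos', hcnt'⟩ := exists_reaches_succ hc (d := 0) (e := 0)
      (hsim.mem_fastStates (E := E)) (by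
        rw [hx, hpos, (scan_eq_right_iff w le_rfl).2 rfl]
        rfl)
    refine ⟨c', hc', ?_⟩
    rw [hx', hpos', hcnt', hpos]
    simpa using hsim
  | succ j ih =>
    rw [Nat.mul_succ] at hd
    obtain ⟨d₁, hd₁, hd₂⟩ := stepsOn_add.1 hd
    obtain ⟨c, hc, hsim⟩ := ih hd₁
    have hpos : c.pos ≤ w.length + 1 := by obtain ⟨_, _, _, -, h, -⟩ := hsim; exact h
    obtain ⟨Z, off, ρ, hx, -⟩ := id hsim
    -- Otherwise `d₁` would occur on both sides of the equation obtained from `hsim.window` and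
    -- could not be eliminated.
    generalize d₁.state = q at hx
    rw [hx] at hsim
    obtain ⟨X, Y, e', hT, rfl, hmar, hstep⟩ := hsim.window hKQ (by omega)
      (z := fun i => decide (c.counter (Fin.castAdd m i) = 0)) (regTest_iff hpos c.counter)
      (fun i => rfl)
    obtain ⟨d', hd', rfl⟩ :=
      (Margin.stepsOn_iff (n := K) (b := 0) (by simpa using hmar) hT).1 hd₂
    have hsim' := hstep d' hd'
    obtain ⟨c', hc', hx', hpos', hcnt'⟩ := exists_reaches_succ hc
      (hsim'.mem_fastStates (E := E)) (by
        rw [hx, mem_fastTrans_sim]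
        exact .inr ⟨d', hd', rfl⟩)
    refine ⟨c', hc', ?_⟩
    rw [hx', hpos', hcnt']
    exact hsim'

/-- The accelerated machine accepts what `M` accepts. -/
theorem fast_acceptsIn (hK : 1 ≤ K) (hKQ : K ≤ Q) (hQ : 2 ≤ Q) (hE : Q ≤ E + 3)
    {S : Finset ℕ} (hS : S.card ≤ m) (hB : E + 3 + 3 * Q * (m + 1) ≤ B)
    (hw : NearlyPeriodic Q S (TapeSymbol.left :: w.map TapeSymbol.letter)) {s : ℕ} (hs : M.AcceptsIn w s) :
    ∃ s', (M.fast m K Q E B).AcceptsIn w s' ∧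
      (s' ≤ w.length ∨ E ≤ s ∧ s' ≤ w.length + 2 + s / K) := by
  have hacc : ∀ c : (M.fast m K Q E B).Config, M.decode m K Q E B c.state = .accept →
      (M.fast m K Q E B).moves w c = ∅ ∧ c.state ∈ (M.fast m K Q E B).final := by
    intro c hc
    refine ⟨Set.eq_empty_iff_forall_notMem.2 fun μ hμ => ?_, ?_⟩
    · rw [mem_moves_fast, hc] at hμ
      cases hsc : scan w c.pos <;> rw [hsc] at hμ <;> exact hμ
    · rw [mem_final_fast, hc]; trivial
  rcases le_or_gt w.length (E + 1) with hn | hn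
  · obtain ⟨c, hc, hx⟩ := exists_reaches_table (M := M) (m := m) (B := B) hK hKQ hQ hE
      (w := w) le_rfl hn
    rw [List.take_length] at hx
    have hinv := fastInv_of_reaches hK hKQ hQ hE hc
    rw [hx] at hinv
    obtain ⟨-, -, hpos, -⟩ := hinv
    refine ⟨_, ⟨c, hc, Set.eq_empty_iff_forall_notMem.2 fun μ hμ => ?_, ?_⟩, .inl le_rfl⟩
    · rw [mem_moves_fast, hx, hpos, (scan_eq_right_iff w le_rfl).2 rfl] at hμ
      exact hμ
    · rw [mem_final_fast, hx]; exact ⟨s, hs⟩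
  obtain ⟨d, hd, hhalt, hfin⟩ := acceptsIn_iff.1 hs
  rcases lt_or_ge s E with hsE | hsE
  · obtain ⟨c, hc, hx⟩ := exists_reaches_table (M := M) (m := m) (B := B) hK hKQ hQ hE
      (s := E + 1) (w := w) (by omega) le_rfl
    have hinv := fastInv_of_reaches hK hKQ hQ hE hc
    rw [hx] at hinv
    obtain ⟨-, -, hpos, -⟩ := hinv
    obtain ⟨c', hc', hx', -, -⟩ := exists_reaches_succ hc (x := .accept) (d := 1) (e := 0)
      trivial (by
        rw [hx, hpos, scan_letter hn]
        exact .inr ⟨by simp; omega, .inl ⟨(prefix_window (by omega)).1.2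
          ⟨s, hsE, d, hd, hhalt, hfin⟩, rfl⟩⟩)
    exact ⟨_, ⟨c', hc', hacc c' hx'⟩, .inl hn⟩
  · have hlong : ∃ c, M.StepsOn (tape w) E M.init c := by
      obtain ⟨b, rfl⟩ := Nat.exists_eq_add_of_le hsE
      obtain ⟨c, hc, -⟩ := stepsOn_add.1 hd
      exact ⟨c, hc⟩
    -- `s / K` full rounds, then the accepting halt within the fewer than `K` remaining steps.
    rw [← Nat.div_add_mod s K] at hd
    obtain ⟨d₁, hd₁, hd₂⟩ := stepsOn_add.1 hd
    obtain ⟨c, hc, hsim⟩ := exists_reaches_sim hK hKQ hQ hE hS hB hw hlong hn hd₁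
    have hpos : c.pos ≤ w.length + 1 := by obtain ⟨_, _, _, -, h, -⟩ := hsim; exact h
    obtain ⟨Z, off, ρ, hx, -⟩ := id hsim
    generalize d₁.state = q at hx
    rw [hx] at hsim
    obtain ⟨X, Y, e', hT, rfl, hmar, -⟩ := hsim.window hKQ (by omega)
      (z := fun i => decide (c.counter (Fin.castAdd m i) = 0)) (regTest_iff hpos c.counter)
      (fun i => rfl)
    obtain ⟨c', hc', hx', -, -⟩ := exists_reaches_succ hc (x := .accept) (d := 0) (e := 0)
      trivial (by
        rw [hx, mem_fastTrans_sim]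
        exact .inl ⟨(hmar.acceptsWithin_iff hT).1
          ⟨_, Nat.mod_lt _ hK, d, hd₂, hhalt, hfin⟩, rfl⟩)
    exact ⟨_, ⟨c', hc', hacc c' hx'⟩, .inr ⟨hsE, by omega⟩⟩

/-- Only a `table` state needs an argument: it is final as soon as the prefix is in the language, so
it must not halt before the input ends. The move to `reject` guarantees that a move always exists
there. -/
theorem mem_language_of_fast (hK : 1 ≤ K) (hKQ : K ≤ Q) (hQ : 2 ≤ Q) (hE : Q ≤ E + 3)
    (hB : E + 3 ≤ B) (h : w ∈ (M.fast m K Q E B).language) : w ∈ M.language := by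
  obtain ⟨s, c, hc, hhalt, hfin⟩ := h
  have hinv := fastInv_of_reaches hK hKQ hQ hE hc
  rw [mem_final_fast] at hfin
  rcases hx : M.decode m K Q E B c.state with p | _ | _ | F | ⟨Z, off, q, ρ⟩ <;>
    rw [hx] at hfin hinv
  · obtain ⟨rfl, hs, hpos, -⟩ := hinv
    rcases hs.lt_or_eq with hs | rfl
    · exfalso
      have key : ∀ x d e, x ∈ M.fastStates m K Q E B →
          (x, d, e) ∉ M.fastTrans m K Q E (.table (w.take s)) (.letter w[s])
            (fun i => decide (c.counter i = 0)) := by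
        intro x d e hx' hμ
        obtain ⟨q, rfl⟩ := exists_decode hx'
        have : (q, d, e) ∈ (M.fast m K Q E B).moves w c := by
          rw [mem_moves_fast, hx, hpos, scan_letter hs]; exact hμ
        rw [hhalt] at this
        exact this
      have hmem := decode_mem c.state
      rw [hx] at hmem
      have hlen : (w.take s).length ≤ E + 1 := hmem
      simp only [List.length_take] at hlen
      by_cases h₁ : (w.take s).length ≤ E
      · refine key (.table (w.take s ++ [w[s]])) 1 0 ?_ (.inl ⟨h₁, rfl⟩)
        change List.length _ ≤ _
        simp only [List.length_append, List.length_singleton]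
        omega
      · by_cases h₂ : M.AcceptsWithin (.left :: (w.take s).map .letter) E M.init
        · exact key .accept 1 0 trivial (.inr ⟨h₁, .inl ⟨h₂, rfl⟩⟩)
        · by_cases h₃ : ∃ c, M.StepsOn (.left :: (w.take s).map .letter) E M.init c
          · exact key (.parse ([], .left :: (w.take s ++ [w[s]]).map .letter)) 1 0
              ⟨by simp, by simp, by simp; omega⟩
              (.inr ⟨h₁, .inr (.inl ⟨h₃, rfl⟩)⟩)
          · exact key .reject 1 0 trivial (.inr ⟨h₁, .inr (.inr ⟨h₂, h₃, rfl⟩)⟩)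
    · rwa [List.take_length] at hfin
  · exact hinv.1
  · exact hfin.elim
  · exact hfin.elim
  · exact hfin.elim

end Complete

end CounterMachine

/-! ### Choice of the constants and the time bounds -/

theorem mainTheorem2 {α : Type*} [Fintype α] (k m : ℕ) (M : CounterMachine α k)
    (ws : List (List α)) (hm : ws.length = m) (hM : M.language ≤ boundLanguage ws)
    (t : ℕ → ℝ) (c : ℝ) (hc : 0 < c) :
    ∃ M' : CounterMachine α (k + m),
      M'.language = M.language ∧
      (M.Deterministic → M'.Deterministic) ∧
      (M.HaltsInTime t → M'.HaltsInTime (fun n => n + c * t n)) ∧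
      (M.AcceptsInTime t → M'.AcceptsInTime (fun n => n + c * t n)) := by
  obtain ⟨K, hK2, hKc⟩ : ∃ K : ℕ, 2 ≤ K ∧ 2 / c ≤ K :=
    ⟨max 2 ⌈2 / c⌉₊, le_max_left _ _, (Nat.le_ceil _).trans (by exact_mod_cast le_max_right _ _)⟩
  obtain ⟨Q, hKQ, hQ⟩ : ∃ Q : ℕ, K ≤ Q ∧ ∀ u ∈ ws, u ≠ [] → u.length ∣ Q := by
    -- The `max 1` keeps empty words from making the product zero.
    refine ⟨K * (ws.map fun u => max 1 u.length).prod, Nat.le_mul_of_pos_right _ ?_, ?_⟩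
    · refine List.prod_pos ?_
      simp
    · intro u hu hne
      have h₁ : max 1 u.length = u.length :=
        max_eq_right (List.length_pos_iff.2 hne)
      have h₂ : max 1 u.length ∈ ws.map fun u => max 1 u.length := List.mem_map_of_mem hu
      rw [h₁] at h₂
      exact (List.dvd_prod h₂).mul_left K
  obtain ⟨E, hQE, hEc⟩ : ∃ E : ℕ, Q ≤ E ∧ 4 / c ≤ E :=
    ⟨max Q ⌈4 / c⌉₊, le_max_left _ _, (Nat.le_ceil _).trans (by exact_mod_cast le_max_right _ _)⟩
  have hK : 1 ≤ K := by omega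
  have hQ2 : 2 ≤ Q := by omega
  have hE : Q ≤ E + 3 := by omega
  obtain ⟨B, hB⟩ : ∃ B, E + 3 + 3 * Q * (m + 1) ≤ B := ⟨_, le_rfl⟩
  have hKpos : (0 : ℝ) < K := by exact_mod_cast hK
  -- Half of `c * T` pays for the overhead `2`, as `E ≥ 4 / c`; the other half pays for the `j`
  -- rounds, as `K ≥ 2 / c`.
  have time : ∀ (n s' j : ℕ) (T : ℝ), s' ≤ n + 2 + j → ((K * j : ℕ) : ℝ) ≤ T → (E : ℝ) ≤ T →
      (s' : ℝ) ≤ n + c * T := by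
    intro n s' j T h₁ h₂ h₃
    have h₄ : (s' : ℝ) ≤ n + 2 + j := by exact_mod_cast h₁
    have h₅ : 4 ≤ c * T := by
      have := hEc.trans h₃
      rwa [div_le_iff₀' hc] at this
    have h₆ : 2 * (j : ℝ) ≤ c * T := by
      rw [div_le_iff₀' hc] at hKc
      push_cast at h₂
      calc 2 * (j : ℝ) ≤ c * K * j := by gcongr
        _ = c * (K * j) := by ring
        _ ≤ c * T := by gcongr
    linarith
  have short : ∀ (n s' : ℕ) (T : ℝ), s' ≤ n → 0 ≤ T → (s' : ℝ) ≤ n + c * T := by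
    intro n s' T h₁ h₂
    have : (s' : ℝ) ≤ n := by exact_mod_cast h₁
    have := mul_nonneg hc.le h₂
    linarith
  have complete : ∀ w s, M.AcceptsIn w s → ∃ s', (M.fast m K Q E B).AcceptsIn w s' ∧
      (s' ≤ w.length ∨ E ≤ s ∧ s' ≤ w.length + 2 + s / K) := by
    intro w s hs
    obtain ⟨S, hS, hw⟩ := TapeParser.exists_nearlyPeriodic ws hQ w (hM ⟨s, hs⟩)
    exact CounterMachine.fast_acceptsIn hK hKQ hQ2 hE (hm ▸ hS) hB hw hs
  have sound : ∀ w ∈ (M.fast m K Q E B).language, w ∈ M.language := fun w hw =>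
    CounterMachine.mem_language_of_fast hK hKQ hQ2 hE (by omega) hw
  refine ⟨M.fast m K Q E B, ?_, fun h => h.fast, fun ht w s' d hd => ?_, fun ht w hw => ?_⟩
  · refine le_antisymm sound fun w hw => ?_
    obtain ⟨s, hs⟩ := hw
    obtain ⟨s', hs', -⟩ := complete w s hs
    exact ⟨s', hs'⟩
  · have ht' : ∀ {s e}, M.StepsOn (CounterMachine.tape w) s M.init e → (s : ℝ) ≤ t w.length :=
      fun h => ht w _ _ (CounterMachine.reaches_iff.2 h)
    -- The computation of zero steps forces `t` to be nonnegative at this length.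
    have h0 : 0 ≤ t w.length := by simpa using ht w 0 _ .zero
    have hinv := CounterMachine.fastInv_of_reaches hK hKQ hQ2 hE hd
    rcases hx : M.decode m K Q E B d.state with p | _ | _ | F | ⟨Z, off, q, ρ⟩ <;>
      rw [hx] at hinv
    · exact short _ _ _ hinv.2.1 h0
    · rcases hinv.2 with h | ⟨⟨e, he⟩, j, e', hs, he'⟩
      · exact short _ _ _ h h0
      · exact time _ _ j _ hs.le (ht' he') (ht' he)
    · exact short _ _ _ hinv h0
    · exact short _ _ _ hinv.1 h0
    · obtain ⟨⟨e, he⟩, j, e', hs, he', -⟩ := hinv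
      exact time _ _ j _ (by omega) (ht' he') (ht' he)
  · obtain ⟨s, hs, hst⟩ := ht w (sound w hw)
    obtain ⟨s', hs', h | ⟨h₁, h₂⟩⟩ := complete w s hs
    · exact ⟨s', hs', short _ _ _ h ((Nat.cast_nonneg s).trans hst)⟩
    · refine ⟨s', hs', time _ _ _ _ h₂ (le_trans ?_ hst) (le_trans ?_ hst)⟩
      · exact_mod_cast Nat.mul_div_le s K
      · exact_mod_cast h₁
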